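/- Let $\mathbb K$ be a field. A dendriform algebra is a $\mathbb K$-vector space $V$ with two bilinear products $\prec,\succ$ such that $$(x\prec y)\prec z=x\prec(y\prec z)+x\prec(y\succ z),\quad (x\succ y)\prec z=x\succ(y\prec z),\quad x\succ(y\succ z)=(x\succ y)\succ z+(x\prec y)\succ z .$$ Put $\widetilde V=\mathbb K\cdot 1\oplus V$, with $1\prec x=x\succ 1=0$ and $x\prec 1=1\succ x=x$ for $x\in V$ (so that $1\prec 1$ and $1\succ 1$ are not defined), and with the associative product $x*y=x\prec y+x\succ y$, $1*1=1$. A dendriform bialgebra structure on $\widetilde V$ is a coassociative linear map $\Delta:\widetilde V\to\widetilde V\otimes\widetilde V$ with $\Delta(1)=1\otimes 1$, for which the projection $\widetilde V\to\mathbb K$ with kernel $V$ is a counit, and such that for all $x,y\in V$ $$\Delta(x\succ y)=x_{(1)}*y_{(1)}\otimes x_{(2)}\succ y_{(2)}+(x\succ y)\otimes 1,\qquad \Delta(x\prec y)=x_{(1)}*y_{(1)}\otimes x_{(2)}\prec y_{(2)}+(x\prec y)\otimes 1,$$ where the terms with $x_{(2)}=y_{(2)}=1$ are omitted. A brace algebra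 is a $\mathbb K$-vector space $B$ with multilinear operations $\{x_1\mid x_2,\dots,x_{n+1}\}$, $n\ge 1$, such that, with the convention $\{x\mid\ \}=x$, $$\{\{z\mid x_1,\dots,x_n\}\mid y_1,\dots,y_m\}=\sum\{z\mid Y_0,\{x_1\mid Y_1\},Y_2,\dots,Y_{2n-2},\{x_n\mid Y_{2n-1}\},Y_{2n}\},$$ the sum being over the ways to cut the sequence $y_1,\dots,y_m$ into successive, possibly empty, intervals $Y_0,\dots,Y_{2n}$. In a dendriform algebra put $\nearrow(x_1,\dots,x_n)=x_1\prec\nearrow(x_2,\dots,x_n)$ and $\searrow(x_1,\dots,x_n)=\searrow(x_1,\dots,x_{n-1})\succ x_n$, with $\nearrow()=\searrow()=1$, and $$\langle x\mid y_1,\dots,y_n\rangle=\sum_{i=0}^{n}(-1)^i\nearrow(y_1,\dots,y_i)\succ x\prec\searrow(y_{i+1},\dots,y_n).$$ For a brace algebra $B$ let $D(B)$ be the free dendriform algebra on the vector space $B$, let $\mathcal U(B)$ be the quotient of $D(B)$ by the dendriform ideal generated by the elements $\langle x\mid y_1,\dots,y_n\rangle-\{x\mid y_1,\dots,y_n\}$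 for $n\ge 1$ and $x,y_1,\dots,y_n\in B$, let $\widetilde{\mathcal U}(B)=\mathbb K\cdot 1\oplus\mathcal U(B)$ be the dendriform enveloping algebra of $B$, and let $\pi:\widetilde D(B)\to\widetilde{\mathcal U}(B)$ be the quotient map. **Proposition.** Let $B$ be a brace algebra over $\mathbb K$. (1) There is a unique linear map $\Delta:\widetilde D(B)\to\widetilde D(B)\otimes\widetilde D(B)$ (the Loday–Ronco coproduct) such that $\Delta(1)=1\otimes 1$ and, for all $x,y\in\widetilde D(B)$ and $v\in B$, $$\Delta(x\succ v\prec y)=(x\succ v\prec y)\otimes 1+x_{(1)}*y_{(1)}\otimes (x_{(2)}\succ v\prec y_{(2)}),$$ and $\Delta$ is a dendriform bialgebra structure on $\widetilde D(B)$. (2) There is a unique linear map $\overline\Delta:\widetilde{\mathcal U}(B)\to\widetilde{\mathcal U}(B)\otimes\widetilde{\mathcal U}(B)$ with $\overline\Delta\circ\pi=(\pi\otimes\pi)\circ\Delta$, and $\overline\Delta$ is a dendriform bialgebra structure on $\widetilde{\mathcal U}(B)$. -/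

import Mathlib

open scoped TensorProduct

noncomputable section

namespace Dendriform

/-! ### Dendriform algebras, ideals and quotients -/

/-- A vector space with two bilinear products `≺` (`prec`) and `≻` (`succ`), no axioms. -/
class DendOps (K W : Type*) [Field K] [AddCommGroup W] [Module K W] where
  prec : W →ₗ[K] W →ₗ[K] W
  succ : W →ₗ[K] W →ₗ[K] W

/-- Dendriform algebras. -/
class DendriformAlgebra (K W : Type*) [Field K] [AddCommGroup W] [Module K W] extends
    DendOps K W where
  prec_prec : ∀ x y z : W, prec (prec x y) z = prec x (prec y z) + prec x (succ y z)
  succ_prec : ∀ x y z : W, prec (succ x y) z = succ x (prec y z)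
  succ_succ : ∀ x y z : W, succ x (succ y z) = succ (succ x y) z + succ (prec x y) z

section Ideal

variable (K : Type*) {W : Type*} [Field K] [AddCommGroup W] [Module K W] [DendOps K W]

/-- The left product `x ≺ y`. -/
abbrev prec : W →ₗ[K] W →ₗ[K] W := DendOps.prec

/-- The right product `x ≻ y`. -/
abbrev succ : W →ₗ[K] W →ₗ[K] W := DendOps.succ

/-- Two-sided ideals for both products. -/
def IsDendIdeal (I : Submodule K W) : Prop :=
  ∀ x ∈ I, ∀ y : W, prec K x y ∈ I ∧ prec K y x ∈ I ∧ succ K x y ∈ I ∧ succ K y x ∈ I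

/-- The smallest ideal containing the set `S`. -/
def dendIdeal (S : Set W) : Submodule K W :=
  sInf {I | IsDendIdeal K I ∧ S ⊆ I}

theorem subset_dendIdeal (S : Set W) {x : W} (hx : x ∈ S) : x ∈ dendIdeal K S :=
  Submodule.mem_sInf.2 fun _ hI => hI.2 hx

theorem isDendIdeal_dendIdeal (S : Set W) : IsDendIdeal K (dendIdeal K S) := by
  intro x hx y
  have h : ∀ I ∈ {I : Submodule K W | IsDendIdeal K I ∧ S ⊆ I},
      prec K x y ∈ I ∧ prec K y x ∈ I ∧ succ K x y ∈ I ∧ succ K y x ∈ I :=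
    fun I hI => hI.1 x (Submodule.mem_sInf.1 hx I hI) y
  exact ⟨Submodule.mem_sInf.2 fun I hI => (h I hI).1,
    Submodule.mem_sInf.2 fun I hI => (h I hI).2.1,
    Submodule.mem_sInf.2 fun I hI => (h I hI).2.2.1,
    Submodule.mem_sInf.2 fun I hI => (h I hI).2.2.2⟩

/-- A bilinear product induced on the quotient by a subspace that is a two-sided ideal for it. -/
def quotMul (I : Submodule K W) (m : W →ₗ[K] W →ₗ[K] W)
    (hl : ∀ x ∈ I, ∀ y, m x y ∈ I) (hr : ∀ x ∈ I, ∀ y, m y x ∈ I) :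
    (W ⧸ I) →ₗ[K] (W ⧸ I) →ₗ[K] (W ⧸ I) :=
  I.liftQ
    { toFun := fun x => I.mapQ I (m x) fun y hy => hr y hy x
      map_add' := fun x x' => by
        apply Submodule.linearMap_qext
        ext y
        simp
      map_smul' := fun a x => by
        apply Submodule.linearMap_qext
        ext y
        simp }
    fun x hx => by
      rw [LinearMap.mem_ker]
      apply Submodule.linearMap_qext
      ext y
      simpa using hl x hx y

instance quotDendOps (S : Set W) : DendOps K (W ⧸ dendIdeal K S) where
  prec := quotMul K (dendIdeal K S) (prec K)
    (fun x hx y => (isDendIdeal_dendIdeal K S x hx y).1)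
    (fun x hx y => (isDendIdeal_dendIdeal K S x hx y).2.1)
  succ := quotMul K (dendIdeal K S) (succ K)
    (fun x hx y => (isDendIdeal_dendIdeal K S x hx y).2.2.1)
    (fun x hx y => (isDendIdeal_dendIdeal K S x hx y).2.2.2)

end Ideal

/-- The quotient of a dendriform algebra by an ideal is a dendriform algebra. -/
instance quotDendriformAlgebra (K : Type*) {W : Type*} [Field K] [AddCommGroup W] [Module K W]
    [DendriformAlgebra K W] (S : Set W) : DendriformAlgebra K (W ⧸ dendIdeal K S) where
  toDendOps := quotDendOps K S
  prec_prec := by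
    intro x y z
    induction x using Submodule.Quotient.induction_on with | _ x
    induction y using Submodule.Quotient.induction_on with | _ y
    induction z using Submodule.Quotient.induction_on with | _ z
    exact congrArg (dendIdeal K S).mkQ (DendriformAlgebra.prec_prec x y z)
  succ_prec := by
    intro x y z
    induction x using Submodule.Quotient.induction_on with | _ x
    induction y using Submodule.Quotient.induction_on with | _ y
    induction z using Submodule.Quotient.induction_on with | _ z
    exact congrArg (dendIdeal K S).mkQ (DendriformAlgebra.succ_prec x y z)
  succ_succ := by
    intro x y z
    induction x using Submodule.Quotient.induction_on with | _ x
    induction y using Submodule.Quotient.induction_on with | _ y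
    induction z using Submodule.Quotient.induction_on with | _ z
    exact congrArg (dendIdeal K S).mkQ (DendriformAlgebra.succ_succ x y z)

/-! ### The free dendriform algebra `D(V)` on a vector space `V` -/

/-- Formal monomials in two binary operations with entries in `V`. -/
inductive DendTerm (V : Type*) where
  | of : V → DendTerm V
  | prec : DendTerm V → DendTerm V → DendTerm V
  | succ : DendTerm V → DendTerm V → DendTerm V

/-- The vector space on the formal monomials is the free algebra with two binary products on the
set `V`. -/
instance termDendOps (K V : Type*) [Field K] : DendOps K (DendTerm V →₀ K) where
  prec := Finsupp.linearCombination K fun s =>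
    Finsupp.linearCombination K fun t => Finsupp.single (DendTerm.prec s t) (1 : K)
  succ := Finsupp.linearCombination K fun s =>
    Finsupp.linearCombination K fun t => Finsupp.single (DendTerm.succ s t) (1 : K)

section Free

variable (K V : Type*) [Field K] [AddCommGroup V] [Module K V]

/-- The defining relations of `D(V)`: linearity of the generators and the three dendriform
axioms. -/
inductive FreeRel : (DendTerm V →₀ K) → Prop where
  | add (v w : V) : FreeRel (Finsupp.single (.of (v + w)) 1 -
      (Finsupp.single (.of v) 1 + Finsupp.single (.of w) 1))
  | smul (a : K) (v : V) : FreeRel (Finsupp.single (.of (a • v)) 1 -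
      a • Finsupp.single (.of v) 1)
  | prec_prec (x y z : DendTerm V →₀ K) : FreeRel (prec K (prec K x y) z -
      (prec K x (prec K y z) + prec K x (succ K y z)))
  | succ_prec (x y z : DendTerm V →₀ K) : FreeRel (prec K (succ K x y) z -
      succ K x (prec K y z))
  | succ_succ (x y z : DendTerm V →₀ K) : FreeRel (succ K x (succ K y z) -
      (succ K (succ K x y) z + succ K (prec K x y) z))

/-- The free dendriform algebra `D(V)` on the vector space `V`. -/
def FreeDend : Type _ := (DendTerm V →₀ K) ⧸ dendIdeal K {x | FreeRel K V x}

instance : AddCommGroup (FreeDend K V) :=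
  inferInstanceAs (AddCommGroup ((DendTerm V →₀ K) ⧸ dendIdeal K {x | FreeRel K V x}))

instance : Module K (FreeDend K V) :=
  inferInstanceAs (Module K ((DendTerm V →₀ K) ⧸ dendIdeal K {x | FreeRel K V x}))

instance : DendOps K (FreeDend K V) :=
  inferInstanceAs (DendOps K ((DendTerm V →₀ K) ⧸ dendIdeal K {x | FreeRel K V x}))

theorem freeRel_eq {x y : DendTerm V →₀ K} (h : FreeRel K V (x - y)) :
    (dendIdeal K {x | FreeRel K V x}).mkQ x = (dendIdeal K {x | FreeRel K V x}).mkQ y :=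
  (Submodule.Quotient.eq _).2 (subset_dendIdeal K {x | FreeRel K V x} h)

instance : DendriformAlgebra K (FreeDend K V) where
  prec_prec := by
    intro x y z
    induction x using Submodule.Quotient.induction_on with | _ x
    induction y using Submodule.Quotient.induction_on with | _ y
    induction z using Submodule.Quotient.induction_on with | _ z
    exact freeRel_eq K V (.prec_prec x y z)
  succ_prec := by
    intro x y z
    induction x using Submodule.Quotient.induction_on with | _ x
    induction y using Submodule.Quotient.induction_on with | _ y
    induction z using Submodule.Quotient.induction_on with | _ z
    exact freeRel_eq K V (.succ_prec x y z)
  succ_succ := by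
    intro x y z
    induction x using Submodule.Quotient.induction_on with | _ x
    induction y using Submodule.Quotient.induction_on with | _ y
    induction z using Submodule.Quotient.induction_on with | _ z
    exact freeRel_eq K V (.succ_succ x y z)

/-- The canonical linear map `V → D(V)`. -/
def freeOf : V →ₗ[K] FreeDend K V where
  toFun v := (dendIdeal K {x | FreeRel K V x}).mkQ (Finsupp.single (.of v) 1)
  map_add' v w := freeRel_eq K V (.add v w)
  map_smul' a v := freeRel_eq K V (.smul a v)

end Free

/-! ### Unital dendriform algebras -/

section Unital

variable (K V : Type*) [Field K] [AddCommGroup V] [Module K V]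

/-- The vector space `K·1 ⊕ V`. -/
abbrev Tilde : Type _ := K × V

/-- The unit `1` of `K·1 ⊕ V`. -/
def tildeOne : Tilde K V := (1, 0)

variable {V}
variable [DendOps K V]

/-- The product `≺` on `W = K·1 ⊕ V`, extended from `V` by `1 ≺ x = 0` and `x ≺ 1 = x` for
`x ∈ V`. The product `1 ≺ 1`, which does not exist, is given the value `0`, so that the terms
in `1 ≺ 1` of a Sweedler sum are omitted. -/
def tildePrec : Tilde K V →ₗ[K] Tilde K V →ₗ[K] Tilde K V :=
  LinearMap.mk₂ K (fun x y => (0, y.1 • x.2 + prec K x.2 y.2))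
    (fun x x' y => by ext <;> simp; abel)
    (fun a x y => by ext <;> simp [smul_comm a])
    (fun x y y' => by ext <;> simp [add_smul]; abel)
    (fun a x y => by ext <;> simp [mul_smul])

/-- The product `≻` on `W = K·1 ⊕ V`, extended from `V` by `1 ≻ x = x` and `x ≻ 1 = 0` for
`x ∈ V`. The product `1 ≻ 1`, which does not exist, is given the value `0`, so that the terms
in `1 ≻ 1` of a Sweedler sum are omitted. -/
def tildeSucc : Tilde K V →ₗ[K] Tilde K V →ₗ[K] Tilde K V :=
  LinearMap.mk₂ K (fun x y => (0, x.1 • y.2 + succ K x.2 y.2))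
    (fun x x' y => by ext <;> simp [add_smul]; abel)
    (fun a x y => by ext <;> simp [mul_smul])
    (fun x y y' => by ext <;> simp; abel)
    (fun a x y => by ext <;> simp [smul_comm a])

/-- The product `*` on `W = K·1 ⊕ V`: `1 * 1 = 1` and `x * y = x ≺ y + x ≻ y` otherwise. -/
def tildeMul : Tilde K V →ₗ[K] Tilde K V →ₗ[K] Tilde K V :=
  LinearMap.mk₂ K (fun x y => (x.1 * y.1, 0))
    (fun x x' y => by ext <;> simp [add_mul])
    (fun a x y => by ext <;> simp [mul_assoc])
    (fun x y y' => by ext <;> simp [mul_add])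
    (fun a x y => by ext <;> simp [mul_left_comm]) + tildePrec K + tildeSucc K

/-- For `v ∈ V`, the bilinear map `(x, y) ↦ x ≻ v ≺ y` on `K·1 ⊕ V` (its values lie in `V`). -/
def vee (v : V) : Tilde K V →ₗ[K] Tilde K V →ₗ[K] Tilde K V :=
  (tildePrec K).comp ((tildeSucc K).flip (0, v))

variable (V) in
/-- The projection of `K·1 ⊕ V` onto `K` with kernel `V`. -/
def tildeCounit : Tilde K V →ₗ[K] K := LinearMap.fst K K V

/-- Dendriform bialgebras: `Δ` is a coproduct making the unital dendriform algebra `W = K·1 ⊕ V`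
a dendriform bialgebra. Here `TensorProduct.map₂ m n` is the bilinear map
`(x ⊗ x', y ⊗ y') ↦ m x y ⊗ n x' y'`. -/
structure IsDendriformBialgebra (Δ : Tilde K V →ₗ[K] Tilde K V ⊗[K] Tilde K V) : Prop where
  coassoc : TensorProduct.assoc K (Tilde K V) (Tilde K V) (Tilde K V) ∘ₗ
    Δ.rTensor (Tilde K V) ∘ₗ Δ = Δ.lTensor (Tilde K V) ∘ₗ Δ
  map_one : Δ (tildeOne K V) = tildeOne K V ⊗ₜ[K] tildeOne K V
  counit_left : ∀ x, (tildeCounit K V).rTensor (Tilde K V) (Δ x) = 1 ⊗ₜ[K] x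
  counit_right : ∀ x, (tildeCounit K V).lTensor (Tilde K V) (Δ x) = x ⊗ₜ[K] 1
  map_succ : ∀ x y : V, Δ (0, succ K x y) =
    TensorProduct.map₂ (tildeMul K) (tildeSucc K) (Δ (0, x)) (Δ (0, y)) +
      (0, succ K x y) ⊗ₜ[K] tildeOne K V
  map_prec : ∀ x y : V, Δ (0, prec K x y) =
    TensorProduct.map₂ (tildeMul K) (tildePrec K) (Δ (0, x)) (Δ (0, y)) +
      (0, prec K x y) ⊗ₜ[K] tildeOne K V

/-- `↗(x₁, …, xₙ) = x₁ ≺ ↗(x₂, …, xₙ)`, with `↗(x) = x` and `↗() = 1`. -/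
def nearrow : List V → Tilde K V
  | [] => tildeOne K V
  | x :: xs => tildePrec K (0, x) (nearrow xs)

/-- `↘(x₁, …, xₙ₊₁) = ↘(x₁, …, xₙ) ≻ xₙ₊₁`, with `↘(x) = x` and `↘() = 1`. -/
def searrow (xs : List V) : Tilde K V :=
  xs.foldl (fun w x => tildeSucc K w (0, x)) (tildeOne K V)

/-- The brace operation of a dendriform algebra,
`⟨x | y₁, …, yₙ⟩ = ∑_{i=0}^{n} (-1)^i ↗(y₁, …, yᵢ) ≻ x ≺ ↘(yᵢ₊₁, …, yₙ)`. -/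
def dendBrace (x : V) (ys : List V) : V :=
  ∑ i ∈ Finset.range (ys.length + 1),
    (-1 : K) ^ i • (vee K x (nearrow K (ys.take i)) (searrow K (ys.drop i))).2

end Unital

/-- The Loday–Ronco coproduct on `K·1 ⊕ D(V)`: `Δ(1) = 1 ⊗ 1` and
`Δ(x ≻ v ≺ y) = (x ≻ v ≺ y) ⊗ 1 + (x₍₁₎ * y₍₁₎) ⊗ (x₍₂₎ ≻ v ≺ y₍₂₎)` for `x, y ∈ K·1 ⊕ D(V)` and
`v ∈ V`. -/
structure IsLodayRoncoCoproduct (K V : Type*) [Field K] [AddCommGroup V] [Module K V]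
    (Δ : Tilde K (FreeDend K V) →ₗ[K] Tilde K (FreeDend K V) ⊗[K] Tilde K (FreeDend K V)) :
    Prop where
  map_one : Δ (tildeOne K (FreeDend K V)) =
    tildeOne K (FreeDend K V) ⊗ₜ[K] tildeOne K (FreeDend K V)
  map_vee : ∀ (v : V) (x y : Tilde K (FreeDend K V)),
    Δ (vee K (freeOf K V v) x y) =
      vee K (freeOf K V v) x y ⊗ₜ[K] tildeOne K (FreeDend K V) +
        TensorProduct.map₂ (tildeMul K) (vee K (freeOf K V v)) (Δ x) (Δ y)

/-! ### Brace algebras -/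

/-- All ways to cut a list into two successive, possibly empty, pieces. -/
def splits {α : Type*} (l : List α) : List (List α × List α) :=
  (List.range (l.length + 1)).map fun i => (l.take i, l.drop i)

/-- The lists `Y₀, {x₁ | Y₁}, Y₂, {x₂ | Y₃}, …, {xₙ | Y₂ₙ₋₁}, Y₂ₙ`, for all the ways to cut the list
`ys` into successive, possibly empty, intervals `Y₀, …, Y₂ₙ`, where `br x Y = {x | Y}`. -/
def braceLists {B : Type*} (br : B → List B → B) : List B → List B → List (List B)
  | [], ys => [ys]
  | x :: xs, ys =>
    (splits ys).flatMap fun p =>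
      (splits p.2).flatMap fun q =>
        (braceLists br xs q.2).map fun l => p.1 ++ br x q.1 :: l

/-- Brace algebras: multilinear operations `{x₁ | x₂, …, xₙ₊₁}`, for `n ≥ 1`, subject to the brace
relations. The operation `brace 0` is the usual convention `{x | } = x`. -/
class BraceAlgebra (K B : Type*) [Field K] [AddCommGroup B] [Module K B] where
  brace : (n : ℕ) → MultilinearMap K (fun _ : Fin (n + 1) => B) B
  brace_zero : ∀ x : B, brace 0 (fun _ => x) = x
  brace_brace : ∀ (z : B) (xs ys : List B),
    brace ys.length (Fin.cons (brace xs.length (Fin.cons z xs.get)) ys.get) =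
      ((braceLists (fun x Y => brace Y.length (Fin.cons x Y.get)) xs ys).map
        fun l => brace l.length (Fin.cons z l.get)).sum

/-! ### The dendriform enveloping algebra of a brace algebra -/

section Enveloping

variable (K B : Type*) [Field K] [AddCommGroup B] [Module K B] [BraceAlgebra K B]

variable {B} in
/-- `{x | y₁, …, yₙ}` in a brace algebra. -/
def brace (x : B) (ys : List B) : B :=
  BraceAlgebra.brace (K := K) ys.length (Fin.cons x ys.get)

/-- The elements `⟨x | y₁, …, yₙ⟩ - {x | y₁, …, yₙ}` of `D(B)`, for `n ≥ 1`. -/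
def envRel : Set (FreeDend K B) :=
  {d | ∃ (x : B) (ys : List B), ys ≠ [] ∧
    d = dendBrace K (freeOf K B x) (ys.map (freeOf K B)) - freeOf K B (brace K x ys)}

/-- The dendriform algebra `U(B)`; the dendriform enveloping algebra of `B` is
`Tilde K (Env K B) = K·1 ⊕ U(B)`. -/
def Env : Type _ := FreeDend K B ⧸ dendIdeal K (envRel K B)

instance : AddCommGroup (Env K B) :=
  inferInstanceAs (AddCommGroup (FreeDend K B ⧸ dendIdeal K (envRel K B)))

instance : Module K (Env K B) :=
  inferInstanceAs (Module K (FreeDend K B ⧸ dendIdeal K (envRel K B)))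

instance : DendriformAlgebra K (Env K B) :=
  inferInstanceAs (DendriformAlgebra K (FreeDend K B ⧸ dendIdeal K (envRel K B)))

/-- The quotient map `D(B) → U(B)`. -/
def envMk : FreeDend K B →ₗ[K] Env K B := (dendIdeal K (envRel K B)).mkQ

/-- The quotient map `K·1 ⊕ D(B) → K·1 ⊕ U(B)`. -/
def tildeEnvMk : Tilde K (FreeDend K B) →ₗ[K] Tilde K (Env K B) :=
  LinearMap.prodMap LinearMap.id (envMk K B)

end Enveloping

end Dendriform

end

noncomputable section

namespace Dendriform

/-! ### The free dendriform algebra: induction and universal property -/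

section FreeDend

/-! Existence on `D(V)` comes from freeness. The kernel of `ε ⊗ ε` on the tensor square of `K·1 ⊕ A`
is a dendriform algebra: multiply the first factors by `*` and the second by `≺` or `≻`, and where
this would require `1 ≺ 1` or `1 ≻ 1`, use instead `(x ⊗ 1) ≺ (y ⊗ 1) = (x ≺ y) ⊗ 1`, and likewise
for `≻`. Lifting `v ↦ v ⊗ 1 + 1 ⊗ v` to a morphism gives `Δ`. Since `(id ⊗ ε) ∘ Δ = id`, the
correction is exactly the term `(x ≺ y) ⊗ 1` of the bialgebra axioms. The counit and coassociativity
identities hold on generators and pass to products (`coassoc_of_product`). For uniqueness, the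
planar binary trees, iterates of `x ≻ v ≺ y` starting from `1`, span `K·1 ⊕ D(V)` (`mem_veeSpan`).

For the enveloping algebra the point is that the relations generate a coideal. Expanding `Δ⟨x | y₁,
…, yₙ⟩` cuts the `y`'s into four intervals `p, q, r, s` and puts `↗(q) * ↘(r)` on the left, `↗(p) ≻
x ≺ ↘(s)` on the right. The alternating sum of `↗(q) * ↘(r)` over the cuts of a nonempty list is
zero (`arrowSum_cons`), so only the term with `1` on the left survives beside `⟨x | y₁, …, yₙ⟩ ⊗ 1`.
Hence the brace of generators is primitive (`freeCoproduct_dendBrace`). As `{x | y₁, …, yₙ}` is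
itself a generator, each relation is a difference of primitives. An ideal generated by primitives is
a coideal, so `Δ` descends, and the bialgebra axioms descend along the surjection `π`. -/

theorem prec_single {K V : Type*} [Field K] (s t : DendTerm V) :
    prec K (Finsupp.single s (1 : K)) (Finsupp.single t 1) = Finsupp.single (.prec s t) 1 := by
  simp [prec, DendOps.prec]

theorem succ_single {K V : Type*} [Field K] (s t : DendTerm V) :
    succ K (Finsupp.single s (1 : K)) (Finsupp.single t 1) = Finsupp.single (.succ s t) 1 := by
  simp [succ, DendOps.succ]

variable {K V : Type*} [Field K] [AddCommGroup V] [Module K V]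

/-- A subspace of `D(V)` that contains `V` and is closed under both products is everything. -/
theorem FreeDend.mem_of_closed (N : Submodule K (FreeDend K V)) (hof : ∀ v, freeOf K V v ∈ N)
    (hprec : ∀ x ∈ N, ∀ y ∈ N, prec K x y ∈ N) (hsucc : ∀ x ∈ N, ∀ y ∈ N, succ K x y ∈ N)
    (x : FreeDend K V) : x ∈ N := by
  obtain ⟨t, rfl⟩ := (dendIdeal K {x | FreeRel K V x}).mkQ_surjective x
  induction t using Finsupp.induction_linear with
  | zero => rw [map_zero]; exact N.zero_mem
  | add f g hf hg => rw [map_add]; exact N.add_mem hf hg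
  | single t a =>
    -- Pulling out the coefficient leaves a monomial with coefficient `1`, which is a product of
    -- smaller ones.
    rw [← mul_one a, ← smul_eq_mul, ← Finsupp.smul_single, map_smul]
    refine N.smul_mem a ?_
    induction t with
    | of v => exact hof v
    | prec s t hs ht => rw [← prec_single]; exact hprec _ hs _ ht
    | succ s t hs ht => rw [← succ_single]; exact hsucc _ hs _ ht

variable {W : Type*} [AddCommGroup W] [Module K W] [DendriformAlgebra K W]

/-- The value of a formal monomial in a dendriform algebra. -/
def DendTerm.eval (f : V →ₗ[K] W) : DendTerm V → W
  | .of v => f v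
  | .prec s t => Dendriform.prec K (s.eval f) (t.eval f)
  | .succ s t => Dendriform.succ K (s.eval f) (t.eval f)

/-- The linear extension of `DendTerm.eval`. -/
def evalLin (f : V →ₗ[K] W) : (DendTerm V →₀ K) →ₗ[K] W :=
  Finsupp.linearCombination K (DendTerm.eval f)

theorem evalLin_single (f : V →ₗ[K] W) (t : DendTerm V) (a : K) :
    evalLin f (Finsupp.single t a) = a • t.eval f := by
  simp [evalLin]

theorem evalLin_prec (f : V →ₗ[K] W) (x y : DendTerm V →₀ K) :
    evalLin f (prec K x y) = prec K (evalLin f x) (evalLin f y) := by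
  induction x using Finsupp.induction_linear with
  | zero => simp
  | add x x' hx hx' => simp only [map_add, LinearMap.add_apply, hx, hx']
  | single s a =>
    induction y using Finsupp.induction_linear with
    | zero => simp
    | add y y' hy hy' => simp only [map_add, hy, hy']
    | single t b =>
      rw [← mul_one a, ← mul_one b, ← smul_eq_mul, ← smul_eq_mul, ← Finsupp.smul_single,
        ← Finsupp.smul_single]
      simp only [map_smul, LinearMap.smul_apply, prec_single, evalLin_single, one_smul,
        DendTerm.eval]

theorem evalLin_succ (f : V →ₗ[K] W) (x y : DendTerm V →₀ K) :
    evalLin f (succ K x y) = succ K (evalLin f x) (evalLin f y) := by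
  induction x using Finsupp.induction_linear with
  | zero => simp
  | add x x' hx hx' => simp only [map_add, LinearMap.add_apply, hx, hx']
  | single s a =>
    induction y using Finsupp.induction_linear with
    | zero => simp
    | add y y' hy hy' => simp only [map_add, hy, hy']
    | single t b =>
      rw [← mul_one a, ← mul_one b, ← smul_eq_mul, ← smul_eq_mul, ← Finsupp.smul_single,
        ← Finsupp.smul_single]
      simp only [map_smul, LinearMap.smul_apply, succ_single, evalLin_single, one_smul,
        DendTerm.eval]

/-- The kernel of a morphism is an ideal, and the relations vanish in any dendriform algebra;
minimality of the generated ideal does the rest. -/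
theorem dendIdeal_le_ker_evalLin (f : V →ₗ[K] W) :
    dendIdeal K {x | FreeRel K V x} ≤ LinearMap.ker (evalLin f) := by
  refine sInf_le ⟨fun x hx y => ?_, fun x hx => ?_⟩
  · rw [LinearMap.mem_ker] at hx
    simp [LinearMap.mem_ker, evalLin_prec, evalLin_succ, hx]
  · change evalLin f x = 0
    cases hx with
    | add v w => simp [evalLin_single, DendTerm.eval]
    | smul a v => simp [evalLin_single, DendTerm.eval]
    | prec_prec x y z =>
      simp only [map_sub, map_add, evalLin_prec, evalLin_succ]
      exact sub_eq_zero.2 (DendriformAlgebra.prec_prec _ _ _)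
    | succ_prec x y z =>
      simp only [map_sub, evalLin_prec, evalLin_succ]
      exact sub_eq_zero.2 (DendriformAlgebra.succ_prec _ _ _)
    | succ_succ x y z =>
      simp only [map_sub, map_add, evalLin_prec, evalLin_succ]
      exact sub_eq_zero.2 (DendriformAlgebra.succ_succ _ _ _)

/-- The universal property of `D(V)`. -/
def FreeDend.lift (f : V →ₗ[K] W) : FreeDend K V →ₗ[K] W :=
  (dendIdeal K {x | FreeRel K V x}).liftQ (evalLin f) (dendIdeal_le_ker_evalLin f)

theorem FreeDend.lift_of (f : V →ₗ[K] W) (v : V) : FreeDend.lift f (freeOf K V v) = f v :=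
  (evalLin_single f (.of v) 1).trans (one_smul K _)

theorem FreeDend.lift_prec (f : V →ₗ[K] W) (x y : FreeDend K V) :
    FreeDend.lift f (prec K x y) = prec K (FreeDend.lift f x) (FreeDend.lift f y) := by
  obtain ⟨x, rfl⟩ := (dendIdeal K {x | FreeRel K V x}).mkQ_surjective x
  obtain ⟨y, rfl⟩ := (dendIdeal K {x | FreeRel K V x}).mkQ_surjective y
  exact evalLin_prec f x y

theorem FreeDend.lift_succ (f : V →ₗ[K] W) (x y : FreeDend K V) :
    FreeDend.lift f (succ K x y) = succ K (FreeDend.lift f x) (FreeDend.lift f y) := by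
  obtain ⟨x, rfl⟩ := (dendIdeal K {x | FreeRel K V x}).mkQ_surjective x
  obtain ⟨y, rfl⟩ := (dendIdeal K {x | FreeRel K V x}).mkQ_surjective y
  exact evalLin_succ f x y

end FreeDend

/-! ### Identities in `K·1 ⊕ A` -/

section Tilde

variable {K A : Type*} [Field K] [AddCommGroup A] [Module K A]

theorem tildePrec_apply [DendOps K A] (x y : Tilde K A) :
    tildePrec K x y = (0, y.1 • x.2 + prec K x.2 y.2) := rfl

theorem tildeSucc_apply [DendOps K A] (x y : Tilde K A) :
    tildeSucc K x y = (0, x.1 • y.2 + succ K x.2 y.2) := rfl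

theorem tildeMul_eq [DendOps K A] (x y : Tilde K A) :
    tildeMul K x y =
      (x.1 * y.1) • tildeOne K A + tildePrec K x y + tildeSucc K x y := by
  simp [tildeMul, tildeOne]

theorem tildeMul_apply [DendOps K A] (x y : Tilde K A) :
    tildeMul K x y =
      (x.1 * y.1, y.1 • x.2 + prec K x.2 y.2 + (x.1 • y.2 + succ K x.2 y.2)) := by
  simp [tildeMul, tildePrec_apply, tildeSucc_apply]

theorem one_tildeMul [DendOps K A] (x : Tilde K A) : tildeMul K (tildeOne K A) x = x := by
  simp [tildeMul_apply, tildeOne]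

theorem tildeMul_one [DendOps K A] (x : Tilde K A) : tildeMul K x (tildeOne K A) = x := by
  simp [tildeMul_apply, tildeOne]

theorem one_tildePrec [DendOps K A] (x : Tilde K A) : tildePrec K (tildeOne K A) x = 0 := by
  simp [tildePrec_apply, tildeOne]

theorem tildePrec_one [DendOps K A] (x : Tilde K A) :
    tildePrec K x (tildeOne K A) = (0, x.2) := by
  simp [tildePrec_apply, tildeOne]

theorem one_tildeSucc [DendOps K A] (x : Tilde K A) :
    tildeSucc K (tildeOne K A) x = (0, x.2) := by
  simp [tildeSucc_apply, tildeOne]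

theorem tildeSucc_one [DendOps K A] (x : Tilde K A) : tildeSucc K x (tildeOne K A) = 0 := by
  simp [tildeSucc_apply, tildeOne]

variable [DendriformAlgebra K A]

/-- Written with `*`, the dendriform axioms hold on all of `K·1 ⊕ A`, unit included: the default `1
≺ 1 = 1 ≻ 1 = 0` is consistent with them, while `1 * 1 = 1`. -/
theorem tildePrec_prec (x y z : Tilde K A) :
    tildePrec K (tildePrec K x y) z = tildePrec K x (tildeMul K y z) := by
  have h := DendriformAlgebra.prec_prec (K := K) x.2 y.2 z.2
  simp only [tildePrec_apply, tildeMul_apply, map_add, map_smul, LinearMap.add_apply,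
    LinearMap.smul_apply, prec, succ, h]
  ext <;> simp
  module

theorem tildeSucc_prec (x y z : Tilde K A) :
    tildePrec K (tildeSucc K x y) z = tildeSucc K x (tildePrec K y z) := by
  have h := DendriformAlgebra.succ_prec (K := K) x.2 y.2 z.2
  simp only [tildePrec_apply, tildeSucc_apply, map_add, map_smul, LinearMap.add_apply,
    LinearMap.smul_apply, prec, succ, h]
  ext <;> simp
  module

theorem tildeSucc_succ (x y z : Tilde K A) :
    tildeSucc K (tildeMul K x y) z = tildeSucc K x (tildeSucc K y z) := by
  have h := DendriformAlgebra.succ_succ (K := K) x.2 y.2 z.2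
  simp only [tildeSucc_apply, tildeMul_apply, map_add, map_smul, LinearMap.add_apply,
    LinearMap.smul_apply, prec, succ, h]
  ext <;> simp
  module

theorem tildeMul_assoc (x y z : Tilde K A) :
    tildeMul K (tildeMul K x y) z = tildeMul K x (tildeMul K y z) := by
  have h1 := DendriformAlgebra.prec_prec (K := K) x.2 y.2 z.2
  have h2 := DendriformAlgebra.succ_prec (K := K) x.2 y.2 z.2
  have h3 := DendriformAlgebra.succ_succ (K := K) x.2 y.2 z.2
  simp only [tildeMul_apply, map_add, map_smul, LinearMap.add_apply,
    LinearMap.smul_apply, prec, succ, h1, h2, h3]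
  ext
  · simp [mul_assoc]
  · module

end Tilde

/-! ### Products on tensor squares -/

/-- Associativity of `*` in one factor combines with a dendriform axiom in the other, so up to four
different products occur in each factor. -/
theorem map₂_map₂_assoc {R M N : Type*} [CommSemiring R] [AddCommMonoid M] [Module R M]
    [AddCommMonoid N] [Module R N] {f f' g g' : M →ₗ[R] M →ₗ[R] M}
    {h h' k k' : N →ₗ[R] N →ₗ[R] N} (hM : ∀ x y z, f (f' x y) z = g x (g' y z))
    (hN : ∀ x y z, h (h' x y) z = k x (k' y z)) (x y z : M ⊗[R] N) :
    TensorProduct.map₂ f h (TensorProduct.map₂ f' h' x y) z =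
      TensorProduct.map₂ g k x (TensorProduct.map₂ g' k' y z) := by
  induction x with
  | zero => simp
  | add x x' hx hx' => simp only [map_add, LinearMap.add_apply, hx, hx']
  | tmul a b =>
    induction y with
    | zero => simp
    | add x x' hx hx' => simp only [map_add, LinearMap.add_apply, hx, hx']
    | tmul c d =>
      induction z with
      | zero => simp
      | add x x' hx hx' => simp only [map_add, hx, hx']
      | tmul e f => simp [TensorProduct.map₂_apply_tmul, hM, hN]

/-- If two linear maps respect bilinear products, so does their tensor product. -/
theorem map_map₂_of_hom {R M N M' N' : Type*} [CommSemiring R] [AddCommMonoid M] [Module R M]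
    [AddCommMonoid N] [Module R N] [AddCommMonoid M'] [Module R M'] [AddCommMonoid N']
    [Module R N'] {f : M →ₗ[R] M →ₗ[R] M} {f' : M' →ₗ[R] M' →ₗ[R] M'}
    {g : N →ₗ[R] N →ₗ[R] N} {g' : N' →ₗ[R] N' →ₗ[R] N'} {φ : M →ₗ[R] M'} {ψ : N →ₗ[R] N'}
    (hφ : ∀ x y, φ (f x y) = f' (φ x) (φ y)) (hψ : ∀ x y, ψ (g x y) = g' (ψ x) (ψ y))
    (x y : M ⊗[R] N) :
    TensorProduct.map φ ψ (TensorProduct.map₂ f g x y) =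
      TensorProduct.map₂ f' g' (TensorProduct.map φ ψ x) (TensorProduct.map φ ψ y) := by
  induction x with
  | zero => simp
  | add x x' hx hx' => simp only [map_add, LinearMap.add_apply, hx, hx']
  | tmul a b =>
    induction y with
    | zero => simp
    | add x x' hx hx' => simp only [map_add, hx, hx']
    | tmul c d => simp [TensorProduct.map₂_apply_tmul, hφ, hψ]

theorem map₂_tmul_tmul {R M N : Type*} [CommSemiring R] [AddCommMonoid M] [Module R M]
    [AddCommMonoid N] [Module R N] (f : M →ₗ[R] M →ₗ[R] M) (g : N →ₗ[R] N →ₗ[R] N) (a c : M)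
    (b d : N) : TensorProduct.map₂ f g (a ⊗ₜ b) (c ⊗ₜ d) = f a c ⊗ₜ g b d := rfl

/-! ### The dendriform structure on the augmentation ideal of the tensor square -/

section Square

variable {K A : Type*} [Field K] [AddCommGroup A] [Module K A]

variable (K A) in
/-- The map `id ⊗ ε` on the tensor square of `K·1 ⊕ A`. -/
def sqProj : Tilde K A ⊗[K] Tilde K A →ₗ[K] Tilde K A :=
  (TensorProduct.rid K (Tilde K A)).toLinearMap ∘ₗ (tildeCounit K A).lTensor (Tilde K A)

theorem sqProj_tmul (x y : Tilde K A) : sqProj K A (x ⊗ₜ y) = y.1 • x := by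
  simp [sqProj, tildeCounit]

theorem sqProj_tmul_one (x : Tilde K A) : sqProj K A (x ⊗ₜ tildeOne K A) = x := by
  simp [sqProj_tmul, tildeOne]

theorem eq_fst_smul_one_add (x : Tilde K A) : x = x.1 • tildeOne K A + (0, x.2) := by
  ext <;> simp [tildeOne]

theorem sqProj_map₂_of_fst_eq_zero (f g : Tilde K A →ₗ[K] Tilde K A →ₗ[K] Tilde K A)
    (hg : ∀ x y, (g x y).1 = 0) (x y : Tilde K A ⊗[K] Tilde K A) :
    sqProj K A (TensorProduct.map₂ f g x y) = 0 := by
  induction x with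
  | zero => simp
  | add x x' hx hx' => simp only [map_add, LinearMap.add_apply, hx, hx', add_zero]
  | tmul a b =>
    induction y with
    | zero => simp
    | add x x' hx hx' => simp only [map_add, hx, hx', add_zero]
    | tmul c d => simp [sqProj_tmul, hg]

variable [DendOps K A]

variable (K A) in
/-- The product `(x ⊗ x') (y ⊗ y') = (x * y) ⊗ (x' ≺ y')`, where `1 ≺ 1 = 0`. -/
abbrev mulPrec := TensorProduct.map₂ (tildeMul K (V := A)) (tildePrec K (V := A))

variable (K A) in
/-- The product `(x ⊗ x') (y ⊗ y') = (x * y) ⊗ (x' ≻ y')`, where `1 ≻ 1 = 0`. -/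
abbrev mulSucc := TensorProduct.map₂ (tildeMul K (V := A)) (tildeSucc K (V := A))

variable (K A) in
/-- The product `(x ⊗ x') (y ⊗ y') = (x * y) ⊗ (x' * y')`. -/
abbrev sqMul := TensorProduct.map₂ (tildeMul K (V := A)) (tildeMul K (V := A))

variable (K A) in
/-- The product `≺` of the tensor square, with `(x ⊗ 1) ≺ (y ⊗ 1) = (x ≺ y) ⊗ 1`. -/
def sqPrec : Tilde K A ⊗[K] Tilde K A →ₗ[K] Tilde K A ⊗[K] Tilde K A →ₗ[K]
    Tilde K A ⊗[K] Tilde K A :=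
  mulPrec K A + ((tildePrec K).compl₁₂ (sqProj K A) (sqProj K A)).compr₂
    ((TensorProduct.mk K (Tilde K A) (Tilde K A)).flip (tildeOne K A))

variable (K A) in
/-- The product `≻` of the tensor square, with `(x ⊗ 1) ≻ (y ⊗ 1) = (x ≻ y) ⊗ 1`. -/
def sqSucc : Tilde K A ⊗[K] Tilde K A →ₗ[K] Tilde K A ⊗[K] Tilde K A →ₗ[K]
    Tilde K A ⊗[K] Tilde K A :=
  mulSucc K A + ((tildeSucc K).compl₁₂ (sqProj K A) (sqProj K A)).compr₂
    ((TensorProduct.mk K (Tilde K A) (Tilde K A)).flip (tildeOne K A))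

theorem sqPrec_apply (x y : Tilde K A ⊗[K] Tilde K A) :
    sqPrec K A x y = mulPrec K A x y +
      tildePrec K (sqProj K A x) (sqProj K A y) ⊗ₜ tildeOne K A := rfl

theorem sqSucc_apply (x y : Tilde K A ⊗[K] Tilde K A) :
    sqSucc K A x y = mulSucc K A x y +
      tildeSucc K (sqProj K A x) (sqProj K A y) ⊗ₜ tildeOne K A := rfl

/-- The second factors of the values lie in `A`, where `ε` vanishes. Thus `id ⊗ ε` sees only the
correction term of `sqPrec`. -/
theorem sqProj_mulPrec (x y : Tilde K A ⊗[K] Tilde K A) : sqProj K A (mulPrec K A x y) = 0 :=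
  sqProj_map₂_of_fst_eq_zero _ _ (fun _ _ => rfl) x y

theorem sqProj_mulSucc (x y : Tilde K A ⊗[K] Tilde K A) : sqProj K A (mulSucc K A x y) = 0 :=
  sqProj_map₂_of_fst_eq_zero _ _ (fun _ _ => rfl) x y

theorem sqProj_sqPrec (x y : Tilde K A ⊗[K] Tilde K A) :
    sqProj K A (sqPrec K A x y) = tildePrec K (sqProj K A x) (sqProj K A y) := by
  rw [sqPrec_apply, map_add, sqProj_mulPrec, sqProj_tmul_one, zero_add]

theorem sqProj_sqSucc (x y : Tilde K A ⊗[K] Tilde K A) :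
    sqProj K A (sqSucc K A x y) = tildeSucc K (sqProj K A x) (sqProj K A y) := by
  rw [sqSucc_apply, map_add, sqProj_mulSucc, sqProj_tmul_one, zero_add]

/-- The convention `1 ≺ y = 0` makes correction terms invisible to a further product on the right;
`mulSucc_tmul_one` is the mirror image. -/
theorem mulPrec_tmul_one (a : Tilde K A) (y : Tilde K A ⊗[K] Tilde K A) :
    mulPrec K A (a ⊗ₜ tildeOne K A) y = 0 := by
  induction y with
  | zero => simp
  | add x x' hx hx' => rw [map_add, hx, hx', add_zero]
  | tmul c d => simp [one_tildePrec]

theorem mulSucc_tmul_one (x : Tilde K A ⊗[K] Tilde K A) (a : Tilde K A) :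
    mulSucc K A x (a ⊗ₜ tildeOne K A) = 0 := by
  induction x with
  | zero => simp
  | add x x' hx hx' => rw [map_add, LinearMap.add_apply, hx, hx', add_zero]
  | tmul c d => simp [tildeSucc_one]

/-- Because `b ≺ 1` is the component of `b` in `A`, this product removes the part of `x` with second
factor in `K·1`. -/
theorem mulPrec_one (x : Tilde K A ⊗[K] Tilde K A) :
    mulPrec K A x (tildeOne K A ⊗ₜ tildeOne K A) = x - sqProj K A x ⊗ₜ tildeOne K A := by
  induction x with
  | zero => simp
  | add x x' hx hx' =>
    rw [map_add, LinearMap.add_apply, hx, hx', map_add, TensorProduct.add_tmul]; abel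
  | tmul c d =>
    rw [map₂_tmul_tmul, tildeMul_one, tildePrec_one, sqProj_tmul,
      TensorProduct.smul_tmul, ← TensorProduct.tmul_sub]
    exact congrArg _ (eq_sub_of_add_eq' (eq_fst_smul_one_add d).symm)

theorem one_mulSucc (x : Tilde K A ⊗[K] Tilde K A) :
    mulSucc K A (tildeOne K A ⊗ₜ tildeOne K A) x = x - sqProj K A x ⊗ₜ tildeOne K A := by
  induction x with
  | zero => simp
  | add x x' hx hx' => rw [map_add, hx, hx', map_add, TensorProduct.add_tmul]; abel
  | tmul c d =>
    rw [map₂_tmul_tmul, one_tildeMul, one_tildeSucc, sqProj_tmul,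
      TensorProduct.smul_tmul, ← TensorProduct.tmul_sub]
    exact congrArg _ (eq_sub_of_add_eq' (eq_fst_smul_one_add d).symm)

/-- In the second factor `*` differs from `≺ + ≻` only by `1 * 1 = 1`, which accounts for the last
term. -/
theorem sqMul_eq_mul (x y : Tilde K A ⊗[K] Tilde K A) :
    sqMul K A x y = mulPrec K A x y + mulSucc K A x y +
      tildeMul K (sqProj K A x) (sqProj K A y) ⊗ₜ tildeOne K A := by
  induction x with
  | zero => simp
  | add x x' hx hx' =>
    simp only [map_add, LinearMap.add_apply, hx, hx', TensorProduct.add_tmul]; abel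
  | tmul a b =>
    induction y with
    | zero => simp
    | add x x' hx hx' => simp only [map_add, hx, hx', TensorProduct.add_tmul]; abel
    | tmul c d =>
      simp only [map₂_tmul_tmul, sqProj_tmul, tildeMul_eq b d, map_smul,
        LinearMap.smul_apply, TensorProduct.tmul_add, TensorProduct.tmul_smul,
        ← TensorProduct.smul_tmul', smul_smul]
      rw [mul_comm]
      abel

/-- The only obstruction to `* = ≺ + ≻` is the product of the scalars `(ε ⊗ ε) x` and `(ε ⊗ ε) y`.
This is why the dendriform structure lives on the kernel of `ε ⊗ ε`. -/
theorem sqMul_eq (x y : Tilde K A ⊗[K] Tilde K A) :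
    sqMul K A x y = ((sqProj K A x).1 * (sqProj K A y).1) • tildeOne K A ⊗ₜ tildeOne K A +
      sqPrec K A x y + sqSucc K A x y := by
  rw [sqMul_eq_mul, sqPrec_apply, sqSucc_apply, tildeMul_eq, TensorProduct.add_tmul,
    TensorProduct.add_tmul, TensorProduct.smul_tmul']
  abel

theorem sqProj_sqMul (x y : Tilde K A ⊗[K] Tilde K A) :
    sqProj K A (sqMul K A x y) = tildeMul K (sqProj K A x) (sqProj K A y) := by
  rw [sqMul_eq_mul, map_add, map_add, sqProj_mulPrec, sqProj_mulSucc, sqProj_tmul_one, zero_add,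
    zero_add]

end Square

section SquareAxioms

variable {K A : Type*} [Field K] [AddCommGroup A] [Module K A] [DendriformAlgebra K A]

/-- The two summands decouple: the main parts satisfy the identity factorwise, and the corrections
satisfy it in `K·1 ⊕ A` after `id ⊗ ε`. -/
theorem sqPrec_prec (x y z : Tilde K A ⊗[K] Tilde K A) :
    sqPrec K A (sqPrec K A x y) z = sqPrec K A x (sqMul K A y z) := by
  rw [sqPrec_apply _ z, sqProj_sqPrec, sqPrec_apply, map_add, LinearMap.add_apply,
    mulPrec_tmul_one, add_zero, sqPrec_apply, sqProj_sqMul, tildePrec_prec,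
    map₂_map₂_assoc tildeMul_assoc tildePrec_prec]

theorem sqSucc_prec (x y z : Tilde K A ⊗[K] Tilde K A) :
    sqPrec K A (sqSucc K A x y) z = sqSucc K A x (sqPrec K A y z) := by
  rw [sqPrec_apply _ z, sqProj_sqSucc, sqSucc_apply, map_add, LinearMap.add_apply,
    mulPrec_tmul_one, add_zero, sqSucc_apply, sqProj_sqPrec, tildeSucc_prec, sqPrec_apply,
    map_add, mulSucc_tmul_one, add_zero, map₂_map₂_assoc tildeMul_assoc tildeSucc_prec]

theorem sqSucc_succ (x y z : Tilde K A ⊗[K] Tilde K A) :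
    sqSucc K A (sqMul K A x y) z = sqSucc K A x (sqSucc K A y z) := by
  rw [sqSucc_apply _ z, sqProj_sqMul, sqSucc_apply, sqProj_sqSucc, tildeSucc_succ, sqSucc_apply,
    map_add, mulSucc_tmul_one, add_zero, map₂_map₂_assoc tildeMul_assoc tildeSucc_succ]

variable (K A) in
/-- The kernel of `ε ⊗ ε`. -/
def sqAug : Submodule K (Tilde K A ⊗[K] Tilde K A) :=
  LinearMap.ker (tildeCounit K A ∘ₗ sqProj K A)

omit [DendriformAlgebra K A] in
theorem mem_sqAug {x : Tilde K A ⊗[K] Tilde K A} : x ∈ sqAug K A ↔ (sqProj K A x).1 = 0 :=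
  Iff.rfl

theorem sqPrec_mem (x y : Tilde K A ⊗[K] Tilde K A) : sqPrec K A x y ∈ sqAug K A := by
  rw [mem_sqAug, sqProj_sqPrec]; rfl

theorem sqSucc_mem (x y : Tilde K A ⊗[K] Tilde K A) : sqSucc K A x y ∈ sqAug K A := by
  rw [mem_sqAug, sqProj_sqSucc]; rfl

theorem sqMul_eq_of_mem {x y : Tilde K A ⊗[K] Tilde K A} (hx : x ∈ sqAug K A) :
    sqMul K A x y = sqPrec K A x y + sqSucc K A x y := by
  rw [sqMul_eq, mem_sqAug.1 hx, zero_mul, zero_smul, zero_add]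

instance : DendriformAlgebra K (sqAug K A) where
  prec := LinearMap.mk₂ K (fun x y => ⟨sqPrec K A x y, sqPrec_mem _ _⟩)
    (fun _ _ _ => Subtype.ext (by simp)) (fun _ _ _ => Subtype.ext (by simp))
    (fun _ _ _ => Subtype.ext (by simp)) (fun _ _ _ => Subtype.ext (by simp))
  succ := LinearMap.mk₂ K (fun x y => ⟨sqSucc K A x y, sqSucc_mem _ _⟩)
    (fun _ _ _ => Subtype.ext (by simp)) (fun _ _ _ => Subtype.ext (by simp))
    (fun _ _ _ => Subtype.ext (by simp)) (fun _ _ _ => Subtype.ext (by simp))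
  prec_prec x y z := Subtype.ext <| by
    change sqPrec K A (sqPrec K A x y) z = sqPrec K A x (sqPrec K A y z) +
      sqPrec K A x (sqSucc K A y z)
    rw [sqPrec_prec, sqMul_eq_of_mem y.2, map_add]
  succ_prec x y z := Subtype.ext (sqSucc_prec (x : Tilde K A ⊗[K] Tilde K A) y z)
  succ_succ x y z := Subtype.ext <| by
    change sqSucc K A x (sqSucc K A y z) = sqSucc K A (sqSucc K A x y) z +
      sqSucc K A (sqPrec K A x y) z
    rw [← sqSucc_succ, sqMul_eq_of_mem x.2, map_add, LinearMap.add_apply, add_comm]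

theorem coe_prec_sqAug (x y : sqAug K A) :
    (sqAug K A).subtype (prec K x y) = sqPrec K A x y := rfl

theorem coe_succ_sqAug (x y : sqAug K A) :
    (sqAug K A).subtype (succ K x y) = sqSucc K A x y := rfl

end SquareAxioms

/-! ### The Loday–Ronco coproduct -/

section Coproduct

variable {K V : Type*} [Field K] [AddCommGroup V] [Module K V]

variable (K V) in
/-- The map `v ↦ v ⊗ 1 + 1 ⊗ v`. -/
def primGen : V →ₗ[K] sqAug K (FreeDend K V) :=
  LinearMap.codRestrict _
    (((TensorProduct.mk K _ _).flip (tildeOne K (FreeDend K V)) +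
      TensorProduct.mk K _ _ (tildeOne K (FreeDend K V))) ∘ₗ
      LinearMap.inr K K (FreeDend K V) ∘ₗ freeOf K V)
    fun v => by simp [mem_sqAug, sqProj_tmul]

variable (K V) in
/-- The Loday–Ronco coproduct on `D(V)`. -/
def freeCoproduct : FreeDend K V →ₗ[K] Tilde K (FreeDend K V) ⊗[K] Tilde K (FreeDend K V) :=
  (sqAug K (FreeDend K V)).subtype ∘ₗ FreeDend.lift (W := sqAug K (FreeDend K V)) (primGen K V)

theorem freeCoproduct_of (v : V) : freeCoproduct K V (freeOf K V v) =
    (0, freeOf K V v) ⊗ₜ tildeOne K (FreeDend K V) +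
      tildeOne K (FreeDend K V) ⊗ₜ (0, freeOf K V v) := by
  rw [freeCoproduct, LinearMap.comp_apply, FreeDend.lift_of]
  rfl

theorem freeCoproduct_prec (x y : FreeDend K V) : freeCoproduct K V (prec K x y) =
    sqPrec K _ (freeCoproduct K V x) (freeCoproduct K V y) := by
  rw [freeCoproduct, LinearMap.comp_apply, FreeDend.lift_prec]
  exact coe_prec_sqAug _ _

theorem freeCoproduct_succ (x y : FreeDend K V) : freeCoproduct K V (succ K x y) =
    sqSucc K _ (freeCoproduct K V x) (freeCoproduct K V y) := by
  rw [freeCoproduct, LinearMap.comp_apply, FreeDend.lift_succ]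
  exact coe_succ_sqAug _ _

variable (K V) in
/-- The Loday–Ronco coproduct on `K·1 ⊕ D(V)`. -/
def lrCoproduct : Tilde K (FreeDend K V) →ₗ[K]
    Tilde K (FreeDend K V) ⊗[K] Tilde K (FreeDend K V) :=
  LinearMap.coprod
    (LinearMap.toSpanSingleton K _ (tildeOne K (FreeDend K V) ⊗ₜ tildeOne K (FreeDend K V)))
    (freeCoproduct K V)

theorem lrCoproduct_apply (x : Tilde K (FreeDend K V)) : lrCoproduct K V x =
    x.1 • tildeOne K (FreeDend K V) ⊗ₜ tildeOne K (FreeDend K V) + freeCoproduct K V x.2 := by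
  simp [lrCoproduct]

theorem lrCoproduct_inr (x : FreeDend K V) : lrCoproduct K V (0, x) = freeCoproduct K V x := by
  simp [lrCoproduct_apply]

theorem lrCoproduct_one : lrCoproduct K V (tildeOne K (FreeDend K V)) =
    tildeOne K (FreeDend K V) ⊗ₜ tildeOne K (FreeDend K V) := by
  simp [lrCoproduct_apply, tildeOne]

/-- The right counit identity comes first because it turns the correction terms of `sqPrec` and
`sqSucc` into `(x ≺ y) ⊗ 1` and `(x ≻ y) ⊗ 1`. -/
theorem sqProj_freeCoproduct (x : FreeDend K V) :
    sqProj K _ (freeCoproduct K V x) = (0, x) := by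
  refine FreeDend.mem_of_closed (LinearMap.eqLocus (sqProj K _ ∘ₗ freeCoproduct K V)
    (LinearMap.inr K K (FreeDend K V))) (fun v => ?_) (fun x hx y hy => ?_)
    (fun x hx y hy => ?_) x
  · simp [LinearMap.mem_eqLocus, freeCoproduct_of, sqProj_tmul, tildeOne]
  · simp only [LinearMap.mem_eqLocus, LinearMap.comp_apply, LinearMap.inr_apply,
      freeCoproduct_prec, sqProj_sqPrec] at *
    simp [hx, hy, tildePrec_apply]
  · simp only [LinearMap.mem_eqLocus, LinearMap.comp_apply, LinearMap.inr_apply,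
      freeCoproduct_succ, sqProj_sqSucc] at *
    simp [hx, hy, tildeSucc_apply]

theorem sqProj_lrCoproduct (x : Tilde K (FreeDend K V)) :
    sqProj K _ (lrCoproduct K V x) = x := by
  rw [lrCoproduct_apply, map_add, map_smul, sqProj_tmul_one, sqProj_freeCoproduct]
  exact (eq_fst_smul_one_add x).symm

/-- The bialgebra axiom extends to arguments involving `1`: with `1 ≺ 1 = 0`, the unit terms are
handled by `mulPrec_tmul_one` and `mulPrec_one`. -/
theorem lrCoproduct_prec (x y : Tilde K (FreeDend K V)) :
    lrCoproduct K V (tildePrec K x y) =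
      mulPrec K _ (lrCoproduct K V x) (lrCoproduct K V y) +
        tildePrec K x y ⊗ₜ tildeOne K (FreeDend K V) := by
  have h : lrCoproduct K V (tildePrec K x y) =
      y.1 • freeCoproduct K V x.2 + freeCoproduct K V (prec K x.2 y.2) := by
    rw [tildePrec_apply, lrCoproduct_inr, map_add, map_smul]
  have h' : tildePrec K x y ⊗ₜ[K] tildeOne K (FreeDend K V) =
      y.1 • (0, x.2) ⊗ₜ tildeOne K (FreeDend K V) +
        (0, prec K x.2 y.2) ⊗ₜ tildeOne K (FreeDend K V) := by
    rw [TensorProduct.smul_tmul', ← TensorProduct.add_tmul]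
    simp [tildePrec_apply]
  rw [h, h', lrCoproduct_apply x, lrCoproduct_apply y, freeCoproduct_prec, sqPrec_apply,
    sqProj_freeCoproduct, sqProj_freeCoproduct]
  simp only [map_add, map_smul, LinearMap.add_apply, LinearMap.smul_apply, mulPrec_tmul_one,
    mulPrec_one, sqProj_tmul_one, sqProj_freeCoproduct, tildePrec_apply, smul_zero, zero_add, zero_smul]
  module

theorem lrCoproduct_succ (x y : Tilde K (FreeDend K V)) :
    lrCoproduct K V (tildeSucc K x y) =
      mulSucc K _ (lrCoproduct K V x) (lrCoproduct K V y) +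
        tildeSucc K x y ⊗ₜ tildeOne K (FreeDend K V) := by
  have h : lrCoproduct K V (tildeSucc K x y) =
      x.1 • freeCoproduct K V y.2 + freeCoproduct K V (succ K x.2 y.2) := by
    rw [tildeSucc_apply, lrCoproduct_inr, map_add, map_smul]
  have h' : tildeSucc K x y ⊗ₜ[K] tildeOne K (FreeDend K V) =
      x.1 • (0, y.2) ⊗ₜ tildeOne K (FreeDend K V) +
        (0, succ K x.2 y.2) ⊗ₜ tildeOne K (FreeDend K V) := by
    rw [TensorProduct.smul_tmul', ← TensorProduct.add_tmul]
    simp [tildeSucc_apply]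
  rw [h, h', lrCoproduct_apply x, lrCoproduct_apply y, freeCoproduct_succ, sqSucc_apply,
    sqProj_freeCoproduct, sqProj_freeCoproduct]
  simp only [map_add, map_smul, LinearMap.add_apply, LinearMap.smul_apply, mulSucc_tmul_one,
    one_mulSucc, sqProj_freeCoproduct, tildeSucc_apply, smul_zero, zero_add, zero_smul]
  module

/-- Multiplicativity for `*` lets `Δ ⊗ id` be applied to the first factors in the coassociativity
argument. -/
theorem lrCoproduct_mul (x y : Tilde K (FreeDend K V)) :
    lrCoproduct K V (tildeMul K x y) =
      sqMul K _ (lrCoproduct K V x) (lrCoproduct K V y) := by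
  rw [sqMul_eq_mul, sqProj_lrCoproduct, sqProj_lrCoproduct, tildeMul_eq, map_add, map_add,
    map_smul, lrCoproduct_one, lrCoproduct_prec, lrCoproduct_succ, TensorProduct.add_tmul,
    TensorProduct.add_tmul, TensorProduct.smul_tmul']
  abel

end Coproduct

/-! ### Counit, coassociativity and the Loday–Ronco formula -/

section Tilde

variable {K A : Type*} [Field K] [AddCommGroup A] [Module K A]

theorem inr_prec [DendOps K A] (x y : A) :
    ((0, prec K x y) : Tilde K A) = tildePrec K (0, x) (0, y) := by
  simp [tildePrec_apply]

theorem inr_succ [DendOps K A] (x y : A) :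
    ((0, succ K x y) : Tilde K A) = tildeSucc K (0, x) (0, y) := by
  simp [tildeSucc_apply]

theorem vee_apply [DendOps K A] (v : A) (x y : Tilde K A) :
    vee K v x y = tildePrec K (tildeSucc K x (0, v)) y := rfl

variable (K A) in
/-- The map `ε ⊗ id` on the tensor square of `K·1 ⊕ A`. -/
def sqProjLeft : Tilde K A ⊗[K] Tilde K A →ₗ[K] Tilde K A :=
  (TensorProduct.lid K (Tilde K A)).toLinearMap ∘ₗ (tildeCounit K A).rTensor (Tilde K A)

theorem sqProjLeft_tmul (x y : Tilde K A) : sqProjLeft K A (x ⊗ₜ y) = x.1 • y := by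
  simp [sqProjLeft, tildeCounit]

/-- `ε` is multiplicative for `*`, since the values of `≺` and `≻` lie in `A`. -/
theorem sqProjLeft_map₂ [DendOps K A] (m : Tilde K A →ₗ[K] Tilde K A →ₗ[K] Tilde K A)
    (x y : Tilde K A ⊗[K] Tilde K A) :
    sqProjLeft K A (TensorProduct.map₂ (tildeMul K) m x y) =
      m (sqProjLeft K A x) (sqProjLeft K A y) := by
  induction x with
  | zero => simp
  | add x x' hx hx' => simp only [map_add, LinearMap.add_apply, hx, hx']
  | tmul a b =>
    induction y with
    | zero => simp
    | add x x' hx hx' => simp only [map_add, hx, hx']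
    | tmul c d =>
      rw [map₂_tmul_tmul, sqProjLeft_tmul, sqProjLeft_tmul, sqProjLeft_tmul, tildeMul_apply]
      simp only [map_smul, LinearMap.smul_apply, mul_smul]
      exact smul_comm _ _ _

end Tilde

theorem assoc_map₂ {R M N P : Type*} [CommSemiring R] [AddCommMonoid M] [Module R M]
    [AddCommMonoid N] [Module R N] [AddCommMonoid P] [Module R P] (f : M →ₗ[R] M →ₗ[R] M)
    (g : N →ₗ[R] N →ₗ[R] N) (h : P →ₗ[R] P →ₗ[R] P) (x y : (M ⊗[R] N) ⊗[R] P) :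
    TensorProduct.assoc R M N P (TensorProduct.map₂ (TensorProduct.map₂ f g) h x y) =
      TensorProduct.map₂ f (TensorProduct.map₂ g h) (TensorProduct.assoc R M N P x)
        (TensorProduct.assoc R M N P y) := by
  induction x with
  | zero => simp
  | add x x' hx hx' => simp only [map_add, LinearMap.add_apply, hx, hx']
  | tmul ab p =>
    induction y with
    | zero => simp
    | add x x' hx hx' => simp only [map_add, hx, hx']
    | tmul cd q =>
      induction ab with
      | zero => simp
      | add x x' hx hx' =>
        simp only [map_add, LinearMap.add_apply, TensorProduct.add_tmul, hx, hx']
      | tmul a b =>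
        induction cd with
        | zero => simp
        | add x x' hx hx' => simp only [map_add, TensorProduct.add_tmul, hx, hx']
        | tmul c d => rfl

section Bialgebra

variable {K V : Type*} [Field K] [AddCommGroup V] [Module K V]

/-- Coassociativity is inherited by the values of a product `m` for which
`Δ (m x y) = (x₍₁₎ * y₍₁₎) ⊗ m x₍₂₎ y₍₂₎ + m x y ⊗ 1`. -/
theorem coassoc_of_product
    (m : Tilde K (FreeDend K V) →ₗ[K] Tilde K (FreeDend K V) →ₗ[K] Tilde K (FreeDend K V))
    (hm : ∀ x y, lrCoproduct K V (m x y) =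
      TensorProduct.map₂ (tildeMul K) m (lrCoproduct K V x) (lrCoproduct K V y) +
        m x y ⊗ₜ tildeOne K (FreeDend K V)) (x y : Tilde K (FreeDend K V))
    (hx : TensorProduct.assoc K _ _ _ ((lrCoproduct K V).rTensor _ (lrCoproduct K V x)) =
      (lrCoproduct K V).lTensor _ (lrCoproduct K V x))
    (hy : TensorProduct.assoc K _ _ _ ((lrCoproduct K V).rTensor _ (lrCoproduct K V y)) =
      (lrCoproduct K V).lTensor _ (lrCoproduct K V y)) :
    TensorProduct.assoc K _ _ _ ((lrCoproduct K V).rTensor _ (lrCoproduct K V (m x y))) =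
      (lrCoproduct K V).lTensor _ (lrCoproduct K V (m x y)) := by
  have hr (X Y : Tilde K (FreeDend K V) ⊗[K] Tilde K (FreeDend K V)) : (lrCoproduct K V).rTensor _ (TensorProduct.map₂ (tildeMul K) m X Y) =
      TensorProduct.map₂ (sqMul K _) m ((lrCoproduct K V).rTensor _ X)
        ((lrCoproduct K V).rTensor _ Y) :=
    map_map₂_of_hom lrCoproduct_mul (fun _ _ => rfl) X Y
  -- Here `Δ` meets `m` in the second factor, so `hm` yields an extra term ending in `⊗ 1`. On the
  -- other side it is matched by part of `Δ (m x y) ⊗ 1`.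
  have hl (X Y : Tilde K (FreeDend K V) ⊗[K] Tilde K (FreeDend K V)) : (lrCoproduct K V).lTensor _ (TensorProduct.map₂ (tildeMul K) m X Y) =
      TensorProduct.map₂ (tildeMul K) (TensorProduct.map₂ (tildeMul K) m)
        ((lrCoproduct K V).lTensor _ X) ((lrCoproduct K V).lTensor _ Y) +
      TensorProduct.assoc K _ _ _
        (TensorProduct.map₂ (tildeMul K) m X Y ⊗ₜ tildeOne K (FreeDend K V)) := by
    induction X with
    | zero => simp
    | add X X' hX hX' =>
      simp only [map_add, LinearMap.add_apply, TensorProduct.add_tmul, hX, hX']; abel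
    | tmul a b =>
      induction Y with
      | zero => simp
      | add X X' hX hX' =>
        simp only [map_add, TensorProduct.add_tmul, hX, hX']; abel
      | tmul c d =>
        rw [map₂_tmul_tmul, LinearMap.lTensor_tmul, hm, TensorProduct.tmul_add]
        rfl
  rw [hm, map_add, map_add, map_add, hr, hl, assoc_map₂, hx, hy, LinearMap.rTensor_tmul, hm,
    LinearMap.lTensor_tmul, lrCoproduct_one, TensorProduct.add_tmul, map_add,
    TensorProduct.assoc_tmul, add_assoc]

theorem lrCoproduct_coassoc (x : Tilde K (FreeDend K V)) :
    TensorProduct.assoc K _ _ _ ((lrCoproduct K V).rTensor _ (lrCoproduct K V x)) =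
      (lrCoproduct K V).lTensor _ (lrCoproduct K V x) := by
  have h (x : FreeDend K V) := FreeDend.mem_of_closed (LinearMap.eqLocus
    ((TensorProduct.assoc K _ _ _).toLinearMap ∘ₗ (lrCoproduct K V).rTensor _ ∘ₗ
      lrCoproduct K V ∘ₗ LinearMap.inr K K (FreeDend K V))
    ((lrCoproduct K V).lTensor _ ∘ₗ lrCoproduct K V ∘ₗ LinearMap.inr K K (FreeDend K V)))
    (fun v => by
      simp only [LinearMap.mem_eqLocus, LinearMap.comp_apply, LinearMap.inr_apply,
        lrCoproduct_inr, freeCoproduct_of, map_add, LinearMap.rTensor_tmul,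
        LinearMap.lTensor_tmul, lrCoproduct_one, TensorProduct.add_tmul, TensorProduct.tmul_add,
        LinearEquiv.coe_coe, TensorProduct.assoc_tmul]
      abel)
    (fun x hx y hy => by
      simp only [LinearMap.mem_eqLocus, LinearMap.comp_apply, LinearMap.inr_apply,
        LinearEquiv.coe_coe, inr_prec] at *
      exact coassoc_of_product _ lrCoproduct_prec _ _ hx hy)
    (fun x hx y hy => by
      simp only [LinearMap.mem_eqLocus, LinearMap.comp_apply, LinearMap.inr_apply,
        LinearEquiv.coe_coe, inr_succ] at *
      exact coassoc_of_product _ lrCoproduct_succ _ _ hx hy) x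
  rw [eq_fst_smul_one_add x]
  simp only [map_add, map_smul, lrCoproduct_one, LinearMap.rTensor_tmul,
    LinearMap.lTensor_tmul, TensorProduct.assoc_tmul]
  exact congrArg _ (h x.2)

theorem sqProjLeft_lrCoproduct (x : Tilde K (FreeDend K V)) :
    sqProjLeft K _ (lrCoproduct K V x) = x := by
  have h (x : FreeDend K V) := FreeDend.mem_of_closed (LinearMap.eqLocus
    (sqProjLeft K _ ∘ₗ lrCoproduct K V ∘ₗ LinearMap.inr K K (FreeDend K V))
    (LinearMap.inr K K (FreeDend K V)))
    (fun v => by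
      simp [LinearMap.mem_eqLocus, lrCoproduct_inr, freeCoproduct_of, sqProjLeft_tmul, tildeOne])
    (fun x hx y hy => by
      simp only [LinearMap.mem_eqLocus, LinearMap.comp_apply, LinearMap.inr_apply,
        inr_prec, lrCoproduct_prec, map_add, sqProjLeft_map₂, sqProjLeft_tmul] at *
      simp [hx, hy, tildePrec_apply])
    (fun x hx y hy => by
      simp only [LinearMap.mem_eqLocus, LinearMap.comp_apply, LinearMap.inr_apply,
        inr_succ, lrCoproduct_succ, map_add, sqProjLeft_map₂, sqProjLeft_tmul] at *
      simp [hx, hy, tildeSucc_apply]) x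
  conv_lhs => rw [eq_fst_smul_one_add x]
  rw [map_add, map_add, map_smul, map_smul, lrCoproduct_one, sqProjLeft_tmul]
  refine Eq.trans ?_ (eq_fst_smul_one_add x).symm
  rw [show sqProjLeft K _ (lrCoproduct K V (0, x.2)) = (0, x.2) from h x.2]
  simp [tildeOne]

theorem lrCoproduct_isDendriformBialgebra : IsDendriformBialgebra K (lrCoproduct K V) where
  coassoc := LinearMap.ext lrCoproduct_coassoc
  map_one := lrCoproduct_one
  counit_left x := (TensorProduct.lid K _).injective <|
    (sqProjLeft_lrCoproduct x).trans (by simp)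
  counit_right x := (TensorProduct.rid K _).injective <|
    (sqProj_lrCoproduct x).trans (by simp)
  map_succ x y := by rw [inr_succ]; exact lrCoproduct_succ _ _
  map_prec x y := by rw [inr_prec]; exact lrCoproduct_prec _ _

/-- Factoring through `1 ⊗ v` makes the formulas for `Δ` of `≻` and `≺` applicable one after the
other. -/
theorem map₂_vee {A : Type*} [AddCommGroup A] [Module K A] [DendOps K A] (v : A)
    (x y : Tilde K A ⊗[K] Tilde K A) :
    TensorProduct.map₂ (tildeMul K) (vee K v) x y =
      mulPrec K A (mulSucc K A x (tildeOne K A ⊗ₜ (0, v))) y := by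
  induction x with
  | zero => simp
  | add x x' hx hx' => simp only [map_add, LinearMap.add_apply, hx, hx']
  | tmul a b =>
    induction y with
    | zero => simp
    | add x x' hx hx' => simp only [map_add, hx, hx']
    | tmul c d =>
      rw [map₂_tmul_tmul, map₂_tmul_tmul, map₂_tmul_tmul, tildeMul_one]
      rfl

/-- Of `Δ(v) = v ⊗ 1 + 1 ⊗ v` only `1 ⊗ v` contributes, since `· ≻ 1 = 0`; the term `(x ≻ v) ⊗ 1`
then dies because `1 ≺ · = 0`. -/
theorem lrCoproduct_isLodayRoncoCoproduct : IsLodayRoncoCoproduct K V (lrCoproduct K V) where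
  map_one := lrCoproduct_one
  map_vee v x y := by
    rw [map₂_vee, vee_apply, lrCoproduct_prec, lrCoproduct_succ, lrCoproduct_inr,
      freeCoproduct_of, map_add, map_add, mulSucc_tmul_one, zero_add, LinearMap.add_apply,
      mulPrec_tmul_one, add_zero, add_comm]

end Bialgebra

/-! ### Uniqueness: `K·1 ⊕ D(V)` is spanned by planar binary trees -/

section Trees

variable (K V : Type*) [Field K] [AddCommGroup V] [Module K V]

/-- The elements obtained from `1` by iterating `(x, y) ↦ x ≻ v ≺ y`, for `v ∈ V`. -/
inductive IsVeeTree : Tilde K (FreeDend K V) → Prop where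
  | one : IsVeeTree (tildeOne K (FreeDend K V))
  | vee (v : V) {x y : Tilde K (FreeDend K V)} : IsVeeTree x → IsVeeTree y →
    IsVeeTree (vee K (freeOf K V v) x y)

/-- The span of the trees. -/
def veeSpan : Submodule K (Tilde K (FreeDend K V)) := Submodule.span K {x | IsVeeTree K V x}

variable {K V}

theorem vee_mem_veeSpan (v : V) {x y : Tilde K (FreeDend K V)} (hx : x ∈ veeSpan K V)
    (hy : y ∈ veeSpan K V) : vee K (freeOf K V v) x y ∈ veeSpan K V := by
  induction hx using Submodule.span_induction with
  | zero => simp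
  | add a b _ _ ha hb => rw [map_add]; exact Submodule.add_mem _ ha hb
  | smul a b _ hb => rw [map_smul]; exact Submodule.smul_mem _ _ hb
  | mem x hx =>
    induction hy using Submodule.span_induction with
    | zero => simp
    | add a b _ _ ha hb => rw [map_add]; exact Submodule.add_mem _ ha hb
    | smul a b _ hb => rw [map_smul]; exact Submodule.smul_mem _ _ hb
    | mem y hy => exact Submodule.subset_span (.vee v hx hy)

theorem one_mem_veeSpan : tildeOne K (FreeDend K V) ∈ veeSpan K V :=
  Submodule.subset_span .one

theorem snd_mem_veeSpan {x : Tilde K (FreeDend K V)} (hx : x ∈ veeSpan K V) :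
    (0, x.2) ∈ veeSpan K V := by
  rw [show ((0, x.2) : Tilde K (FreeDend K V)) = x - x.1 • tildeOne K (FreeDend K V) from
    eq_sub_of_add_eq' (eq_fst_smul_one_add x).symm]
  exact Submodule.sub_mem _ hx (Submodule.smul_mem _ _ one_mem_veeSpan)

/-- Products of trees are computed by recursion: `(x ≻ v ≺ y) ≺ t = x ≻ v ≺ (y * t)` and `s ≻ (x' ≻
v' ≺ y') = (s * x') ≻ v' ≺ y'`. The first decreases `s`; the second decreases `t` with `s` fixed. -/
theorem IsVeeTree.products_mem {s : Tilde K (FreeDend K V)} (hs : IsVeeTree K V s) :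
    ∀ {t}, IsVeeTree K V t → tildePrec K s t ∈ veeSpan K V ∧ tildeSucc K s t ∈ veeSpan K V ∧
      tildeMul K s t ∈ veeSpan K V := by
  induction hs with
  | one =>
    intro t ht
    have := Submodule.subset_span (R := K) ht
    rw [one_tildePrec, one_tildeSucc, one_tildeMul]
    exact ⟨Submodule.zero_mem _, snd_mem_veeSpan this, this⟩
  | @vee v x y hx hy _ ihy =>
    intro t ht
    have hs := Submodule.subset_span (R := K) (IsVeeTree.vee v hx hy)
    have hprec : tildePrec K (Dendriform.vee K (freeOf K V v) x y) t ∈ veeSpan K V := by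
      rw [vee_apply, tildePrec_prec]
      exact vee_mem_veeSpan v (Submodule.subset_span hx) (ihy ht).2.2
    have hmul {t} (hp : tildePrec K (Dendriform.vee K (freeOf K V v) x y) t ∈ veeSpan K V)
        (h : tildeSucc K (Dendriform.vee K (freeOf K V v) x y) t ∈ veeSpan K V) :
        tildeMul K (Dendriform.vee K (freeOf K V v) x y) t ∈ veeSpan K V := by
      rw [tildeMul_eq]
      exact Submodule.add_mem _ (Submodule.add_mem _
        (Submodule.smul_mem _ _ one_mem_veeSpan) hp) h
    refine ⟨hprec, ?_⟩
    induction ht with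
    | one => rw [tildeSucc_one, tildeMul_one]; exact ⟨Submodule.zero_mem _, hs⟩
    | @vee v' x' y' hx' hy' ihx' _ =>
      -- The claim `hprec` depends on `t`, so the inner induction hypothesis takes it as a premise,
      -- to be proved again for `x'`.
      have hx'' := (ihx' (by
        rw [vee_apply, tildePrec_prec]
        exact vee_mem_veeSpan v (Submodule.subset_span hx) (ihy hx').2.2)).2
      have h : tildeSucc K (Dendriform.vee K (freeOf K V v) x y)
          (Dendriform.vee K (freeOf K V v') x' y') ∈ veeSpan K V := by
        rw [vee_apply _ x', ← tildeSucc_prec, ← tildeSucc_succ]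
        exact vee_mem_veeSpan v' hx'' (Submodule.subset_span hy')
      exact ⟨h, hmul hprec h⟩

theorem products_mem_veeSpan {x y : Tilde K (FreeDend K V)} (hx : x ∈ veeSpan K V)
    (hy : y ∈ veeSpan K V) :
    tildePrec K x y ∈ veeSpan K V ∧ tildeSucc K x y ∈ veeSpan K V := by
  induction hx using Submodule.span_induction with
  | zero => simp
  | add a b _ _ ha hb =>
    simp only [map_add, LinearMap.add_apply]
    exact ⟨Submodule.add_mem _ ha.1 hb.1, Submodule.add_mem _ ha.2 hb.2⟩
  | smul a b _ hb =>
    simp only [map_smul, LinearMap.smul_apply]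
    exact ⟨Submodule.smul_mem _ _ hb.1, Submodule.smul_mem _ _ hb.2⟩
  | mem x hx =>
    induction hy using Submodule.span_induction with
    | zero => simp
    | add a b _ _ ha hb =>
      simp only [map_add]
      exact ⟨Submodule.add_mem _ ha.1 hb.1, Submodule.add_mem _ ha.2 hb.2⟩
    | smul a b _ hb =>
      simp only [map_smul]
      exact ⟨Submodule.smul_mem _ _ hb.1, Submodule.smul_mem _ _ hb.2⟩
    | mem y hy => exact ⟨(hx.products_mem hy).1, (hx.products_mem hy).2.1⟩

theorem mem_veeSpan (x : Tilde K (FreeDend K V)) : x ∈ veeSpan K V := by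
  rw [eq_fst_smul_one_add x]
  refine Submodule.add_mem _ (Submodule.smul_mem _ _ one_mem_veeSpan)
    (FreeDend.mem_of_closed ((veeSpan K V).comap (LinearMap.inr K K (FreeDend K V)))
      (fun v => ?_) (fun x hx y hy => ?_) (fun x hx y hy => ?_) x.2)
  · have := vee_mem_veeSpan v one_mem_veeSpan one_mem_veeSpan (K := K)
    rwa [vee_apply, one_tildeSucc, tildePrec_one] at this
  · rw [Submodule.mem_comap, LinearMap.inr_apply, inr_prec]
    exact (products_mem_veeSpan hx hy).1
  · rw [Submodule.mem_comap, LinearMap.inr_apply, inr_succ]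
    exact (products_mem_veeSpan hx hy).2

theorem IsLodayRoncoCoproduct.unique
    {Δ Δ' : Tilde K (FreeDend K V) →ₗ[K] Tilde K (FreeDend K V) ⊗[K] Tilde K (FreeDend K V)}
    (h : IsLodayRoncoCoproduct K V Δ) (h' : IsLodayRoncoCoproduct K V Δ') : Δ = Δ' := by
  refine LinearMap.ext fun x => ?_
  refine LinearMap.eqOn_span (s := {x | IsVeeTree K V x}) (fun x hx => ?_) (mem_veeSpan x)
  induction hx with
  | one => rw [h.map_one, h'.map_one]
  | vee v _ _ hx hy => rw [h.map_vee, h'.map_vee, hx, hy]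

end Trees

/-! ### Sums over the ways to cut a list in two -/

section SplitSum

variable {α M : Type*} [AddCommMonoid M]

/-- The sum of `F a b` over all `a`, `b` with `a ++ b = l`. -/
def splitSum (F : List α → List α → M) : List α → M
  | [] => F [] []
  | y :: l => F [] (y :: l) + splitSum (fun a b => F (y :: a) b) l

theorem splitSum_nil (F : List α → List α → M) : splitSum F [] = F [] [] := rfl

theorem splitSum_cons (F : List α → List α → M) (y : α) (l : List α) :
    splitSum F (y :: l) = F [] (y :: l) + splitSum (fun a b => F (y :: a) b) l := rfl

theorem splitSum_eq_sum_range (F : List α → List α → M) (l : List α) :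
    splitSum F l = ∑ i ∈ Finset.range (l.length + 1), F (l.take i) (l.drop i) := by
  induction l generalizing F with
  | nil => simp [splitSum_nil]
  | cons y l ih =>
    rw [splitSum_cons, ih, List.length_cons, Finset.sum_range_succ' _ (l.length + 1), add_comm]
    rfl

/-- Peeling from the right end is needed for `↘`, which is built up by its last entry. -/
theorem splitSum_append_singleton (F : List α → List α → M) (l : List α) (y : α) :
    splitSum F (l ++ [y]) = splitSum (fun a b => F a (b ++ [y])) l + F (l ++ [y]) [] := by
  induction l generalizing F with
  | nil => simp [splitSum_nil, splitSum_cons]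
  | cons z l ih => rw [List.cons_append, splitSum_cons, ih, splitSum_cons, add_assoc]; rfl

theorem splitSum_congr {F G : List α → List α → M} {l : List α}
    (h : ∀ a b, a ++ b = l → F a b = G a b) : splitSum F l = splitSum G l := by
  induction l generalizing F G with
  | nil => exact h [] [] rfl
  | cons y l ih =>
    rw [splitSum_cons, splitSum_cons, h [] (y :: l) rfl,
      ih fun a b hab => h (y :: a) b (by rw [List.cons_append, hab])]

theorem splitSum_add (F G : List α → List α → M) (l : List α) :
    splitSum (fun a b => F a b + G a b) l = splitSum F l + splitSum G l := by
  simp only [splitSum_eq_sum_range, Finset.sum_add_distrib]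

theorem splitSum_eq_left {F : List α → List α → M} (h : ∀ y a b, F (y :: a) b = 0)
    (l : List α) : splitSum F l = F [] l := by
  cases l with
  | nil => rfl
  | cons y l => rw [splitSum_cons, splitSum_eq_sum_range]; simp [h]

/-- Both sides run over the cuts of `l` into three pieces: deconcatenation is coassociative. -/
theorem splitSum_assoc (G : List α → List α → List α → M) (l : List α) :
    splitSum (fun a b => splitSum (fun c d => G c d b) a) l =
      splitSum (fun a b => splitSum (fun c d => G a c d) b) l := by
  induction l generalizing G with
  | nil => rfl
  | cons y l ih =>
    rw [splitSum_cons, splitSum_cons]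
    simp only [splitSum_cons, splitSum_nil, splitSum_add, ih, add_assoc]

theorem map_splitSum {N 𝓕 : Type*} [AddCommMonoid N] [FunLike 𝓕 M N] [AddMonoidHomClass 𝓕 M N]
    (φ : 𝓕) (F : List α → List α → M) (l : List α) :
    φ (splitSum F l) = splitSum (fun a b => φ (F a b)) l := by
  simp only [splitSum_eq_sum_range, map_sum]

theorem smul_splitSum {R : Type*} [DistribSMul R M] (r : R) (F : List α → List α → M)
    (l : List α) : r • splitSum F l = splitSum (fun a b => r • F a b) l := by
  simp only [splitSum_eq_sum_range, Finset.smul_sum]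

theorem map₂_splitSum {R M N P : Type*} [CommSemiring R] [AddCommMonoid M] [Module R M]
    [AddCommMonoid N] [Module R N] [AddCommMonoid P] [Module R P] (f : M →ₗ[R] N →ₗ[R] P)
    (F : List α → List α → M) (G : List α → List α → N) (l m : List α) :
    f (splitSum F l) (splitSum G m) =
      splitSum (fun a b => splitSum (fun c d => f (F a b) (G c d)) m) l := by
  simp only [splitSum_eq_sum_range, map_sum, LinearMap.sum_apply]
  exact Finset.sum_comm

end SplitSum

/-! ### The brace of primitive elements is primitive -/

section Arrows

variable {K A : Type*} [Field K] [AddCommGroup A] [Module K A]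

theorem nearrow_cons [DendOps K A] (y : A) (l : List A) :
    nearrow K (y :: l) = tildePrec K (0, y) (nearrow K l) := rfl

theorem nearrow_nil [DendOps K A] : nearrow K ([] : List A) = tildeOne K A := rfl

theorem searrow_nil [DendOps K A] : searrow K ([] : List A) = tildeOne K A := rfl

theorem searrow_append_singleton [DendOps K A] (l : List A) (y : A) :
    searrow K (l ++ [y]) = tildeSucc K (searrow K l) (0, y) := by
  simp [searrow]

theorem inr_dendBrace [DendOps K A] (x : A) (ys : List A) :
    ((0, dendBrace K x ys) : Tilde K A) =
      splitSum (fun a b => (-1 : K) ^ a.length • vee K x (nearrow K a) (searrow K b)) ys := by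
  have h : LinearMap.inr K K A (dendBrace K x ys) = splitSum (fun a b =>
      LinearMap.inr K K A
        ((-1 : K) ^ a.length • (vee K x (nearrow K a) (searrow K b)).2)) ys := by
    rw [splitSum_eq_sum_range, dendBrace, map_sum]
    refine Finset.sum_congr rfl fun i hi => ?_
    -- The sign uses the length of the first piece, which is `i` because `i` does not exceed the
    -- length of `ys`.
    rw [List.length_take, min_eq_left (Nat.lt_succ_iff.1 (Finset.mem_range.1 hi))]
  refine h.trans (congrFun (congrArg _ ?_) ys)
  funext a b
  ext <;> simp [vee_apply, tildePrec_apply]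

/-- The alternating sum of the products `↗(y₁, …, yᵢ) * ↘(yᵢ₊₁, …, yₙ)`. -/
def arrowSum [DendOps K A] (ys : List A) : Tilde K A :=
  splitSum (fun a b => (-1 : K) ^ a.length • tildeMul K (nearrow K a) (searrow K b)) ys

theorem arrowSum_nil [DendOps K A] : arrowSum (K := K) ([] : List A) = tildeOne K A := by
  simp [arrowSum, splitSum_nil, nearrow_nil, searrow_nil, tildeMul_one]

variable [DendriformAlgebra K A]

/-- The cut with empty first piece vanishes as `1 ≺ · = 0`. In all others `y ≺` factors out by `(y ≺
a) ≺ b = y ≺ (a * b)`, and the extra entry flips the sign. -/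
theorem splitSum_arrow_prec (y : A) (l : List A) :
    splitSum (fun a b => (-1 : K) ^ a.length • tildePrec K (nearrow K a) (searrow K b))
      (y :: l) = -tildePrec K (0, y) (arrowSum l) := by
  rw [splitSum_cons, nearrow_nil, one_tildePrec, smul_zero, zero_add, arrowSum,
    ← LinearMap.neg_apply, ← map_neg, map_splitSum]
  refine splitSum_congr fun a b _ => ?_
  rw [nearrow_cons, tildePrec_prec, List.length_cons, pow_succ, mul_neg_one, neg_smul, map_neg,
    LinearMap.neg_apply, map_smul]

/-- The mirror image, by `a ≻ (b ≻ y) = (a * b) ≻ y`; the entry joins the second piece, so no sign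
appears. -/
theorem splitSum_arrow_succ (l : List A) (y : A) :
    splitSum (fun a b => (-1 : K) ^ a.length • tildeSucc K (nearrow K a) (searrow K b))
      (l ++ [y]) = tildeSucc K (arrowSum l) (0, y) := by
  rw [splitSum_append_singleton, searrow_nil, tildeSucc_one, smul_zero, add_zero, arrowSum,
    ← LinearMap.flip_apply (tildeSucc K), map_splitSum]
  refine splitSum_congr fun a b _ => ?_
  rw [searrow_append_singleton, ← tildeSucc_succ, map_smul, LinearMap.flip_apply]

theorem nearrow_fst (y : A) (l : List A) : (nearrow K (y :: l)).1 = 0 := rfl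

theorem searrow_fst {l : List A} (hl : l ≠ []) : (searrow K l).1 = 0 := by
  obtain ⟨l, y, rfl⟩ := List.eq_nil_or_concat' l |>.resolve_left hl
  rw [searrow_append_singleton]; rfl

/-- One piece of a cut of a nonempty list is nonempty, so `1 * 1` never occurs and `*` splits into
`≺` and `≻`. -/
theorem arrowSum_eq {l : List A} (hl : l ≠ []) : arrowSum (K := K) l =
    splitSum (fun a b => (-1 : K) ^ a.length • tildePrec K (nearrow K a) (searrow K b)) l +
    splitSum (fun a b => (-1 : K) ^ a.length • tildeSucc K (nearrow K a) (searrow K b)) l := by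
  rw [← splitSum_add]
  refine splitSum_congr fun a b hab => ?_
  have h : (nearrow K a).1 * (searrow K b).1 = 0 := by
    cases a with
    | nil => rw [searrow_fst (by rintro rfl; exact hl hab.symm), mul_zero]
    | cons y a => rw [nearrow_fst, zero_mul]
  rw [tildeMul_eq, h, zero_smul, zero_add, smul_add]

/-- The `≺` part is minus `y₁ ≺` the sum for the tail, the `≻` part is the sum for the initial
segment `≻ yₙ`. For one entry these are `-y` and `y`; for longer lists both vanish by induction. -/
theorem arrowSum_cons (y : A) (l : List A) : arrowSum (K := K) (y :: l) = 0 := by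
  induction hn : l.length generalizing y l with
  | zero =>
    rw [List.length_eq_zero_iff] at hn
    subst hn
    rw [arrowSum_eq (by simp), splitSum_arrow_prec, ← List.nil_append [y], splitSum_arrow_succ,
      arrowSum_nil, tildePrec_one, one_tildeSucc, neg_add_cancel]
  | succ n ih =>
    obtain ⟨z, l', rfl⟩ := List.exists_cons_of_length_eq_add_one hn
    obtain ⟨m, w, h⟩ := (List.eq_nil_or_concat' (z :: l')).resolve_left (by simp)
    have hm : m.length = n := by
      have := congrArg List.length h
      simp at this hn
      omega
    rw [arrowSum_eq (by simp), splitSum_arrow_prec, ih z l' (by simpa using hn), h,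
      ← List.cons_append, splitSum_arrow_succ, ih y m hm]
    simp

end Arrows

section Primitive

variable {K V : Type*} [Field K] [AddCommGroup V] [Module K V]

/-- In `y ≺ ↗(l)` only the part `1 ⊗ y` of `Δ(y)` contributes: `y` joins the first piece, which sits
in the right factor. -/
theorem lrCoproduct_nearrow (ys : List V) :
    lrCoproduct K V (nearrow K (ys.map (freeOf K V))) =
      splitSum (fun a b => nearrow K b ⊗ₜ nearrow K a) (ys.map (freeOf K V)) := by
  induction ys with
  | nil => exact lrCoproduct_one
  | cons y l ih =>
    rw [List.map_cons, nearrow_cons, lrCoproduct_prec, lrCoproduct_inr, freeCoproduct_of, ih,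
      map_add, LinearMap.add_apply, mulPrec_tmul_one, zero_add, splitSum_cons, map_splitSum,
      add_comm, nearrow_nil, nearrow_cons]
    simp only [map₂_tmul_tmul, one_tildeMul, nearrow_cons]

theorem lrCoproduct_searrow (ys : List V) :
    lrCoproduct K V (searrow K (ys.map (freeOf K V))) =
      splitSum (fun a b => searrow K a ⊗ₜ searrow K b) (ys.map (freeOf K V)) := by
  induction ys using List.reverseRecOn with
  | nil => exact lrCoproduct_one
  | append_singleton l y ih =>
    rw [List.map_append, List.map_singleton, searrow_append_singleton, lrCoproduct_succ,
      lrCoproduct_inr, freeCoproduct_of, ih, map_add, mulSucc_tmul_one, zero_add,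
      splitSum_append_singleton, ← LinearMap.flip_apply (mulSucc K _), map_splitSum,
      searrow_nil, searrow_append_singleton]
    simp only [LinearMap.flip_apply, map₂_tmul_tmul, tildeMul_one, searrow_append_singleton]

/-- `⟨x | y₁, …, yₙ⟩` is primitive when `x, y₁, …, yₙ ∈ V`. -/
theorem freeCoproduct_dendBrace (x : V) (ys : List V) :
    freeCoproduct K V (dendBrace K (freeOf K V x) (ys.map (freeOf K V))) =
      (0, dendBrace K (freeOf K V x) (ys.map (freeOf K V))) ⊗ₜ tildeOne K (FreeDend K V) +
      tildeOne K (FreeDend K V) ⊗ₜ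
        (0, dendBrace K (freeOf K V x) (ys.map (freeOf K V))) := by
  set zs := ys.map (freeOf K V) with hzs
  have hvee (a b : List (FreeDend K V)) (hab : a ++ b = zs) :
      lrCoproduct K V ((-1 : K) ^ a.length • vee K (freeOf K V x) (nearrow K a) (searrow K b)) =
      ((-1 : K) ^ a.length • vee K (freeOf K V x) (nearrow K a) (searrow K b)) ⊗ₜ
        tildeOne K (FreeDend K V) +
      splitSum (fun p q => splitSum (fun r s => (-1 : K) ^ p.length •
        ((-1 : K) ^ q.length • tildeMul K (nearrow K q) (searrow K r)) ⊗ₜ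
          vee K (freeOf K V x) (nearrow K p) (searrow K s)) b) a := by
    -- The pieces are lifted to lists in `V`, as the coproducts of `↗` and `↘` are known for
    -- generators only.
    obtain ⟨a, b, rfl, rfl, rfl⟩ := List.map_eq_append_iff.1 (hzs.symm.trans hab.symm)
    rw [map_smul, lrCoproduct_isLodayRoncoCoproduct.map_vee, lrCoproduct_nearrow,
      lrCoproduct_searrow, map₂_splitSum, smul_add, TensorProduct.smul_tmul',
      smul_splitSum]
    refine congrArg _ (splitSum_congr fun p q hpq => ?_)
    rw [smul_splitSum, ← hpq]
    refine splitSum_congr fun r s _ => ?_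
    rw [map₂_tmul_tmul, List.length_append, pow_add, mul_smul,
      TensorProduct.smul_tmul']
  rw [← lrCoproduct_inr, inr_dendBrace, map_splitSum, splitSum_congr hvee, splitSum_add,
    splitSum_assoc (fun p q b => splitSum (fun r s => (-1 : K) ^ p.length •
        ((-1 : K) ^ q.length • tildeMul K (nearrow K q) (searrow K r)) ⊗ₜ[K]
          vee K (freeOf K V x) (nearrow K p) (searrow K s)) b)]
  congr 1
  · exact (map_splitSum ((TensorProduct.mk K _ _).flip (tildeOne K (FreeDend K V))) _ _).symm
  · refine Eq.trans (splitSum_congr fun p e _ => ?_)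
      (map_splitSum (TensorProduct.mk K _ _ (tildeOne K (FreeDend K V))) _ _).symm
    -- Regrouping the cut `p, q, r, s` brings the middle intervals `q` and `r` together, so that
    -- their sum is an `arrowSum`.
    rw [← splitSum_assoc (fun q r s => (-1 : K) ^ p.length •
        ((-1 : K) ^ q.length • tildeMul K (nearrow K q) (searrow K r)) ⊗ₜ[K]
          vee K (freeOf K V x) (nearrow K p) (searrow K s))]
    have h (f s : List (FreeDend K V)) : splitSum (fun q r => (-1 : K) ^ p.length •
        ((-1 : K) ^ q.length • tildeMul K (nearrow K q) (searrow K r)) ⊗ₜ[K]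
          vee K (freeOf K V x) (nearrow K p) (searrow K s)) f =
        arrowSum f ⊗ₜ ((-1 : K) ^ p.length •
          vee K (freeOf K V x) (nearrow K p) (searrow K s)) := by
      refine Eq.trans ?_ (map_splitSum ((TensorProduct.mk K _ _).flip
        ((-1 : K) ^ p.length • vee K (freeOf K V x) (nearrow K p) (searrow K s))) _ f).symm
      refine splitSum_congr fun q r _ => ?_
      rw [LinearMap.flip_apply, TensorProduct.mk_apply, TensorProduct.tmul_smul]
    simp only [h]
    -- Only the empty middle interval survives, and its `arrowSum` is `1`.
    rw [splitSum_eq_left fun y a b => by rw [arrowSum_cons, TensorProduct.zero_tmul],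
      arrowSum_nil]
    rfl

end Primitive

/-! ### Descent along a surjective morphism -/

section Descent

variable {K A A' : Type*} [Field K] [AddCommGroup A] [Module K A] [AddCommGroup A'] [Module K A']

/-- The map `K·1 ⊕ A → K·1 ⊕ A'` induced by a linear map. -/
abbrev tildeMap (φ : A →ₗ[K] A') : Tilde K A →ₗ[K] Tilde K A' :=
  LinearMap.prodMap LinearMap.id φ

theorem tildeMap_surjective {φ : A →ₗ[K] A'} (h : Function.Surjective φ) :
    Function.Surjective (tildeMap φ) :=
  Prod.map_surjective.2 ⟨Function.surjective_id, h⟩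

theorem tildeMap_one (φ : A →ₗ[K] A') : tildeMap φ (tildeOne K A) = tildeOne K A' := by
  simp [tildeOne]

theorem tildeMap_inr (φ : A →ₗ[K] A') (x : A) : tildeMap φ (0, x) = (0, φ x) := rfl

variable [DendOps K A] [DendOps K A'] {φ : A →ₗ[K] A'}

theorem tildeMap_prec (h : ∀ x y, φ (prec K x y) = prec K (φ x) (φ y)) (x y : Tilde K A) :
    tildeMap φ (tildePrec K x y) = tildePrec K (tildeMap φ x) (tildeMap φ y) := by
  simp [tildePrec_apply, h]

theorem tildeMap_succ (h : ∀ x y, φ (succ K x y) = succ K (φ x) (φ y)) (x y : Tilde K A) :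
    tildeMap φ (tildeSucc K x y) = tildeSucc K (tildeMap φ x) (tildeMap φ y) := by
  simp [tildeSucc_apply, h]

theorem tildeMap_mul (hp : ∀ x y, φ (prec K x y) = prec K (φ x) (φ y))
    (hs : ∀ x y, φ (succ K x y) = succ K (φ x) (φ y)) (x y : Tilde K A) :
    tildeMap φ (tildeMul K x y) = tildeMul K (tildeMap φ x) (tildeMap φ y) := by
  simp [tildeMul_apply, hp, hs]

/-- Each axiom is an identity natural in the algebra, so it can be checked on preimages. -/
theorem IsDendriformBialgebra.of_surjective (hφ : Function.Surjective φ)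
    (hp : ∀ x y, φ (prec K x y) = prec K (φ x) (φ y))
    (hs : ∀ x y, φ (succ K x y) = succ K (φ x) (φ y))
    {Δ : Tilde K A →ₗ[K] Tilde K A ⊗[K] Tilde K A}
    {Δ' : Tilde K A' →ₗ[K] Tilde K A' ⊗[K] Tilde K A'} (hΔ : IsDendriformBialgebra K Δ)
    (h : Δ' ∘ₗ tildeMap φ = TensorProduct.map (tildeMap φ) (tildeMap φ) ∘ₗ Δ) :
    IsDendriformBialgebra K Δ' := by
  have hx (x : Tilde K A) :
      Δ' (tildeMap φ x) = TensorProduct.map (tildeMap φ) (tildeMap φ) (Δ x) :=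
    LinearMap.congr_fun h x
  have hcounit : tildeCounit K A' ∘ₗ tildeMap φ = tildeCounit K A := rfl
  refine ⟨LinearMap.ext fun x => ?_, ?_, fun x => ?_, fun x => ?_, fun x y => ?_, fun x y => ?_⟩
  · obtain ⟨x, rfl⟩ := tildeMap_surjective hφ x
    have hr : Δ'.rTensor _ (TensorProduct.map (tildeMap φ) (tildeMap φ) (Δ x)) =
        TensorProduct.map (TensorProduct.map (tildeMap φ) (tildeMap φ)) (tildeMap φ)
          (Δ.rTensor _ (Δ x)) := by
      rw [← LinearMap.comp_apply, LinearMap.rTensor_comp_map, h, ← LinearMap.map_comp_rTensor]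
      rfl
    have hl : Δ'.lTensor _ (TensorProduct.map (tildeMap φ) (tildeMap φ) (Δ x)) =
        TensorProduct.map (tildeMap φ) (TensorProduct.map (tildeMap φ) (tildeMap φ))
          (Δ.lTensor _ (Δ x)) := by
      rw [← LinearMap.comp_apply, LinearMap.lTensor_comp_map, h, ← LinearMap.map_comp_lTensor]
      rfl
    have hc := LinearMap.congr_fun hΔ.coassoc x
    simp only [LinearMap.comp_apply, LinearEquiv.coe_coe] at hc ⊢
    rw [hx, hr, hl, ← TensorProduct.map_map_assoc, hc]
  · rw [← tildeMap_one φ, hx, hΔ.map_one, TensorProduct.map_tmul]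
  · obtain ⟨x, rfl⟩ := tildeMap_surjective hφ x
    rw [hx, ← LinearMap.comp_apply, LinearMap.rTensor_comp_map, hcounit,
      ← LinearMap.lTensor_comp_rTensor, LinearMap.comp_apply, hΔ.counit_left,
      LinearMap.lTensor_tmul]
  · obtain ⟨x, rfl⟩ := tildeMap_surjective hφ x
    rw [hx, ← LinearMap.comp_apply, LinearMap.lTensor_comp_map, hcounit,
      ← LinearMap.rTensor_comp_lTensor, LinearMap.comp_apply, hΔ.counit_right,
      LinearMap.rTensor_tmul]
  · obtain ⟨x, rfl⟩ := hφ x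
    obtain ⟨y, rfl⟩ := hφ y
    rw [← hs, ← tildeMap_inr φ, ← tildeMap_inr φ, ← tildeMap_inr φ, hx, hx, hx, hΔ.map_succ, map_add,
      map_map₂_of_hom (tildeMap_mul hp hs) (tildeMap_succ hs), TensorProduct.map_tmul,
      tildeMap_one]
  · obtain ⟨x, rfl⟩ := hφ x
    obtain ⟨y, rfl⟩ := hφ y
    rw [← hp, ← tildeMap_inr φ, ← tildeMap_inr φ, ← tildeMap_inr φ, hx, hx, hx, hΔ.map_prec, map_add,
      map_map₂_of_hom (tildeMap_mul hp hs) (tildeMap_prec hp), TensorProduct.map_tmul,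
      tildeMap_one]

end Descent

/-! ### The coproduct of the enveloping algebra -/

section Enveloping

variable {K B : Type*} [Field K] [AddCommGroup B] [Module K B] [BraceAlgebra K B]

theorem envMk_surjective : Function.Surjective (envMk K B) := Submodule.mkQ_surjective _

theorem envMk_eq_zero {x : FreeDend K B} : envMk K B x = 0 ↔ x ∈ dendIdeal K (envRel K B) :=
  Submodule.Quotient.mk_eq_zero _

theorem envMk_prec (x y : FreeDend K B) :
    envMk K B (prec K x y) = prec K (envMk K B x) (envMk K B y) := rfl

theorem envMk_succ (x y : FreeDend K B) :
    envMk K B (succ K x y) = succ K (envMk K B x) (envMk K B y) := rfl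

theorem freeCoproduct_of_mem_envRel {x : FreeDend K B} (hx : x ∈ envRel K B) :
    freeCoproduct K B x = (0, x) ⊗ₜ tildeOne K (FreeDend K B) +
      tildeOne K (FreeDend K B) ⊗ₜ (0, x) := by
  obtain ⟨z, ys, _, rfl⟩ := hx
  have h (a b : FreeDend K B) : ((0, a - b) : Tilde K (FreeDend K B)) = (0, a) - (0, b) := by
    simp
  rw [map_sub, freeCoproduct_dendBrace, freeCoproduct_of, h, TensorProduct.sub_tmul,
    TensorProduct.tmul_sub]
  abel

/-- The ideal of relations is a coideal. -/
theorem map_envMk_freeCoproduct_eq_zero {x : FreeDend K B} (hx : x ∈ dendIdeal K (envRel K B)) :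
    TensorProduct.map (tildeEnvMk K B) (tildeEnvMk K B) (freeCoproduct K B x) = 0 := by
  -- The kernel alone is not visibly an ideal: `Δ(x ≺ y)` contains `(x ≺ y) ⊗ 1`, which `π ⊗ π`
  -- kills once `x ≺ y` lies in the ideal of relations. The intersection is an ideal containing the
  -- relations.
  have hle : dendIdeal K (envRel K B) ≤ dendIdeal K (envRel K B) ⊓
      LinearMap.ker (TensorProduct.map (tildeEnvMk K B) (tildeEnvMk K B) ∘ₗ
        freeCoproduct K B) := by
    have hπ {x : FreeDend K B} (hx : x ∈ dendIdeal K (envRel K B)) :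
        tildeEnvMk K B (0, x) = 0 := Prod.ext rfl (envMk_eq_zero.2 hx)
    have hp := fun x y => map_map₂_of_hom (tildeMap_mul (φ := envMk K B) envMk_prec envMk_succ)
      (tildeMap_prec (K := K) (φ := envMk K B) envMk_prec) x y
    have hs := fun x y => map_map₂_of_hom (tildeMap_mul (φ := envMk K B) envMk_prec envMk_succ)
      (tildeMap_succ (K := K) (φ := envMk K B) envMk_succ) x y
    refine sInf_le ⟨fun x hx y => ?_, fun x hx => ?_⟩
    · have hI := isDendIdeal_dendIdeal K (envRel K B) x hx.1 y
      have h0 : TensorProduct.map (tildeMap (envMk K B)) (tildeMap (envMk K B))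
        (lrCoproduct K B (0, x)) = 0 := by rw [lrCoproduct_inr]; exact hx.2
      refine ⟨⟨hI.1, ?_⟩, ⟨hI.2.1, ?_⟩, ⟨hI.2.2.1, ?_⟩, ⟨hI.2.2.2, ?_⟩⟩
      all_goals
        rw [SetLike.mem_coe, LinearMap.mem_ker, LinearMap.comp_apply, ← lrCoproduct_inr]
      · rw [lrCoproduct_isDendriformBialgebra.map_prec, map_add, TensorProduct.map_tmul,
          hπ hI.1, TensorProduct.zero_tmul, add_zero]
        refine (hp _ _).trans ?_
        rw [h0, map_zero, LinearMap.zero_apply]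
      · rw [lrCoproduct_isDendriformBialgebra.map_prec, map_add, TensorProduct.map_tmul,
          hπ hI.2.1, TensorProduct.zero_tmul, add_zero]
        refine (hp _ _).trans ?_
        rw [h0, map_zero]
      · rw [lrCoproduct_isDendriformBialgebra.map_succ, map_add, TensorProduct.map_tmul,
          hπ hI.2.2.1, TensorProduct.zero_tmul, add_zero]
        refine (hs _ _).trans ?_
        rw [h0, map_zero, LinearMap.zero_apply]
      · rw [lrCoproduct_isDendriformBialgebra.map_succ, map_add, TensorProduct.map_tmul,
          hπ hI.2.2.2, TensorProduct.zero_tmul, add_zero]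
        refine (hs _ _).trans ?_
        rw [h0, map_zero]
    · have hxI := subset_dendIdeal K _ hx
      refine ⟨hxI, ?_⟩
      rw [SetLike.mem_coe, LinearMap.mem_ker, LinearMap.comp_apply,
        freeCoproduct_of_mem_envRel hx, map_add, TensorProduct.map_tmul, TensorProduct.map_tmul,
        hπ hxI, TensorProduct.zero_tmul, TensorProduct.tmul_zero, add_zero]
  exact (hle hx).2

theorem exists_envCoproduct :
    ∃ ΔU : Tilde K (Env K B) →ₗ[K] Tilde K (Env K B) ⊗[K] Tilde K (Env K B),
      ΔU ∘ₗ tildeEnvMk K B =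
        TensorProduct.map (tildeEnvMk K B) (tildeEnvMk K B) ∘ₗ lrCoproduct K B := by
  -- A linear section of `π` exists over a field; since `(π ⊗ π) ∘ Δ` vanishes on the kernel of `π`,
  -- composing with it gives the induced map.
  obtain ⟨s, hs⟩ := (tildeEnvMk K B).exists_rightInverse_of_surjective
    (LinearMap.range_eq_top.2 (tildeMap_surjective envMk_surjective))
  refine ⟨TensorProduct.map (tildeEnvMk K B) (tildeEnvMk K B) ∘ₗ lrCoproduct K B ∘ₗ s,
    LinearMap.ext fun x => ?_⟩
  have hx : tildeEnvMk K B (s (tildeEnvMk K B x) - x) = 0 := by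
    rw [map_sub, ← LinearMap.comp_apply (tildeEnvMk K B) s, hs, LinearMap.id_apply, sub_self]
  have hker {z : Tilde K (FreeDend K B)} (hz : tildeEnvMk K B z = 0) :
      TensorProduct.map (tildeEnvMk K B) (tildeEnvMk K B) (lrCoproduct K B z) = 0 := by
    rw [lrCoproduct_apply, show z.1 = 0 from congrArg Prod.fst hz, zero_smul, zero_add]
    exact map_envMk_freeCoproduct_eq_zero (envMk_eq_zero.1 (congrArg Prod.snd hz))
  have := hker hx
  rw [map_sub, map_sub, sub_eq_zero] at this
  exact this

end Enveloping

end Dendriform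

end

theorem mainTheorem4 (K B : Type*) [Field K] [AddCommGroup B] [Module K B]
    [Dendriform.BraceAlgebra K B] :
    ∃ (ΔD : Dendriform.Tilde K (Dendriform.FreeDend K B) →ₗ[K]
        Dendriform.Tilde K (Dendriform.FreeDend K B) ⊗[K]
          Dendriform.Tilde K (Dendriform.FreeDend K B))
      (ΔU : Dendriform.Tilde K (Dendriform.Env K B) →ₗ[K]
        Dendriform.Tilde K (Dendriform.Env K B) ⊗[K] Dendriform.Tilde K (Dendriform.Env K B)),
      (Dendriform.IsLodayRoncoCoproduct K B ΔD ∧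
        (∀ Δ', Dendriform.IsLodayRoncoCoproduct K B Δ' → Δ' = ΔD) ∧
        Dendriform.IsDendriformBialgebra K ΔD) ∧
      (ΔU ∘ₗ Dendriform.tildeEnvMk K B =
          TensorProduct.map (Dendriform.tildeEnvMk K B) (Dendriform.tildeEnvMk K B) ∘ₗ ΔD ∧
        (∀ Δ', Δ' ∘ₗ Dendriform.tildeEnvMk K B =
          TensorProduct.map (Dendriform.tildeEnvMk K B) (Dendriform.tildeEnvMk K B) ∘ₗ ΔD →
            Δ' = ΔU) ∧
        Dendriform.IsDendriformBialgebra K ΔU) := by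
  obtain ⟨ΔU, hU⟩ := Dendriform.exists_envCoproduct (K := K) (B := B)
  refine ⟨Dendriform.lrCoproduct K B, ΔU,
    ⟨Dendriform.lrCoproduct_isLodayRoncoCoproduct,
      fun Δ' h => h.unique Dendriform.lrCoproduct_isLodayRoncoCoproduct,
      Dendriform.lrCoproduct_isDendriformBialgebra⟩, hU, fun Δ' h => ?_,
    Dendriform.lrCoproduct_isDendriformBialgebra.of_surjective Dendriform.envMk_surjective
      Dendriform.envMk_prec Dendriform.envMk_succ hU⟩
  exact (LinearMap.cancel_right
    (Dendriform.tildeMap_surjective Dendriform.envMk_surjective)).1 (h.trans hU.symm)
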